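/- Throughout, subgroups of profinite groups are closed and homomorphisms are continuous. A profinite group $G$ is just infinite if it is infinite and every nontrivial closed normal subgroup of $G$ has finite index; it is hereditarily just infinite if in addition every open subgroup of $G$ is just infinite. It is virtually pro-$p$ if it has an open pro-$p$ subgroup. For a finite group $X$, $\mathrm{O}_p(X)$ is the largest normal $p$-subgroup of $X$ and $\Phi(X)$ is the Frattini subgroup of $X$. For subgroups $A \neq \{1\}$ and $H$ of a finite group with $A \trianglelefteq H$, $\mathrm{M}_H(A)$ is the intersection of all maximal $H$-invariant subgroups of $A$, that is, of all maximal elements among the proper subgroups of $A$ normalized by $H$. **Theorem.** Let $p$ be a prime and let $\Lambda = \{(G_n)_{n>0},\ \rho_n : G_{n+1} \twoheadrightarrow G_n\}$ be an inverse system of finite groups and surjective homomorphisms. Let $F_n = \Phi(\mathrm{O}_p(G_n))$, let $\{1\} < A_n \trianglelefteq F_n$, and let $P_n = \rho_n(A_{n+1})$ for $n > 0$. Suppose that the following conditions hold for all $n > 0$: (i) $\mathrm{M}_{F_{n+1}}(A_{n+1}) \ge \ker \rho_n \ge P_{n+1}$; (ii) each normal subgroup of $F_n$ contains $P_n$ or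 is contained in $A_n$ (or both); (iii) $F_{n+1} = \rho_n^{-1}(F_n)$; (iv) every minimal normal subgroup of $G_1$ is contained in $F_1$. Then $G = \varprojlim G_n$ is hereditarily just infinite and virtually pro-$p$. Conversely, every hereditarily just infinite virtually pro-$p$ group is isomorphic, as a topological group, to the limit of such an inverse system. -/

import Mathlib

universe u

/-- `G` is a profinite group: a compact, Hausdorff, totally disconnected topological group. -/
structure IsProfiniteGroup (G : Type u) [Group G] [TopologicalSpace G] : Prop where
  isTopologicalGroup : IsTopologicalGroup G
  compactSpace : CompactSpace G
  t2Space : T2Space G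
  totallyDisconnectedSpace : TotallyDisconnectedSpace G

/-- A profinite group is just infinite if it is infinite and every nontrivial closed normal
subgroup has finite index. -/
structure IsJustInfinite (G : Type u) [Group G] [TopologicalSpace G] : Prop where
  profinite : IsProfiniteGroup G
  infinite : Infinite G
  finiteIndex : ∀ N : Subgroup G, IsClosed (N : Set G) → N.Normal → N ≠ ⊥ → N.FiniteIndex

/-- A profinite group is hereditarily just infinite if it is just infinite and every open
subgroup of it is just infinite. -/
structure IsHereditarilyJustInfinite (G : Type u) [Group G] [TopologicalSpace G] : Prop where
  justInfinite : IsJustInfinite G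
  of_isOpen : ∀ H : Subgroup G, IsOpen (H : Set G) → IsJustInfinite H

/-- A pro-`p` group: a profinite group in which every open normal subgroup has index a power
of `p`. -/
structure IsProPGroup (p : ℕ) (G : Type u) [Group G] [TopologicalSpace G] : Prop where
  profinite : IsProfiniteGroup G
  index_eq_pow : ∀ N : Subgroup G, IsOpen (N : Set G) → N.Normal → ∃ k : ℕ, N.index = p ^ k

/-- A virtually pro-`p` group: a profinite group with an open pro-`p` subgroup. -/
structure IsVirtuallyProPGroup (p : ℕ) (G : Type u) [Group G] [TopologicalSpace G] : Prop where
  profinite : IsProfiniteGroup G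
  exists_open : ∃ H : Subgroup G, IsOpen (H : Set G) ∧ IsProPGroup p H

/-- `O_p(G)`, the subgroup generated by all normal `p`-subgroups (for finite `G` it is the largest
normal `p`-subgroup). -/
def pCore (p : ℕ) (G : Type u) [Group G] : Subgroup G :=
  sSup {N : Subgroup G | N.Normal ∧ IsPGroup p N}

/-- `Φ(O_p(G))`, the Frattini subgroup of `O_p(G)`, as a subgroup of the finite group `G`. -/
def frattiniPCore (p : ℕ) (G : Type u) [Group G] : Subgroup G :=
  (frattini (pCore p G)).map (pCore p G).subtype

/-- `N` is a normal subgroup of the subgroup `H` of `G`. -/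
def IsNormalIn {G : Type u} [Group G] (N H : Subgroup G) : Prop :=
  N ≤ H ∧ (N.subgroupOf H).Normal

/-- `M_H(A)`, the intersection of all maximal `H`-invariant subgroups of `A`, i.e. of all maximal
elements among the proper subgroups of `A` normalized by `H` (used for finite groups, where
openness is automatic). -/
def invariantMelnikov {G : Type u} [Group G] (H A : Subgroup G) : Subgroup G :=
  sInf {B : Subgroup G |
    Maximal (fun C : Subgroup G => C < A ∧ H ≤ Subgroup.normalizer (C : Set G)) B}

/-- An inverse system `G₁ ↞ G₂ ↞ G₃ ↞ ⋯` of finite groups and surjective homomorphisms. Here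
`Λ.G n` is the `(n + 1)`-st group of the system, so that the first one is `Λ.G 0`. -/
structure FiniteInverseSystem where
  G : ℕ → Type u
  [group : ∀ n, Group (G n)]
  [finite : ∀ n, Finite (G n)]
  ρ : ∀ n, G (n + 1) →* G n
  surjective : ∀ n, Function.Surjective (ρ n)

namespace FiniteInverseSystem

attribute [instance] FiniteInverseSystem.group FiniteInverseSystem.finite

/-- The finite groups of the system carry the discrete topology. -/
instance (Λ : FiniteInverseSystem.{u}) (n : ℕ) : TopologicalSpace (Λ.G n) := ⊥

instance (Λ : FiniteInverseSystem.{u}) (n : ℕ) : DiscreteTopology (Λ.G n) := ⟨rfl⟩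

/-- The inverse limit, as a subgroup of the product, with the topology induced by the product
topology. -/
def limit (Λ : FiniteInverseSystem.{u}) : Subgroup (∀ n, Λ.G n) where
  carrier := {x | ∀ n, Λ.ρ n (x (n + 1)) = x n}
  one_mem' := by intro n; simp
  mul_mem' := by
    intro x y hx hy n
    simp only [Set.mem_ofPred_eq] at hx hy
    simp [hx n, hy n]
  inv_mem' := by
    intro x hx n
    simp only [Set.mem_ofPred_eq] at hx
    simp [hx n]

/-- `F_n = Φ(O_p(G_n))`. -/
def F (p : ℕ) (Λ : FiniteInverseSystem.{u}) (n : ℕ) : Subgroup (Λ.G n) :=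
  frattiniPCore p (Λ.G n)

/-- `P_n = ρ_n(A_{n+1})`. -/
def P (Λ : FiniteInverseSystem.{u}) (A : ∀ n, Subgroup (Λ.G n)) (n : ℕ) : Subgroup (Λ.G n) :=
  (A (n + 1)).map (Λ.ρ n)

/-- The conditions on an inverse system `Λ` with chosen subgroups `{1} < A_n ⊴ F_n`. -/
structure IsAdmissible (p : ℕ) (Λ : FiniteInverseSystem.{u}) (A : ∀ n, Subgroup (Λ.G n)) :
    Prop where
  ne_bot : ∀ n, A n ≠ ⊥
  isNormalIn : ∀ n, IsNormalIn (A n) (Λ.F p n)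
  ker_le : ∀ n, (Λ.ρ n).ker ≤ invariantMelnikov (Λ.F p (n + 1)) (A (n + 1))
  le_ker : ∀ n, Λ.P A (n + 1) ≤ (Λ.ρ n).ker
  le_or_le : ∀ n, ∀ N : Subgroup (Λ.G n), IsNormalIn N (Λ.F p n) → Λ.P A n ≤ N ∨ N ≤ A n
  F_succ : ∀ n, Λ.F p (n + 1) = (Λ.F p n).comap (Λ.ρ n)
  minimal_normal_le : ∀ N : Subgroup (Λ.G 0),
    Minimal (fun K : Subgroup (Λ.G 0) => K.Normal ∧ K ≠ ⊥) N → N ≤ Λ.F p 0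

end FiniteInverseSystem

/-! From the system to the group. Let O and F be the preimages in G of O_p and Φ(O_p) of the first
group; conditions (i) and (iii) make them the preimages of O_p(G_n) and F_n for every n. Let L be a
nontrivial closed subgroup of F normalized by F. If the image of L in G_n lay in A_n, its image one
level down would lie in P_{n-1}, hence in a kernel, and would vanish two levels down. So for large n
the image contains P_n by (ii), then A_{n+1} by the Melnikov half of (i), then all later kernels,
and L is open (`exists_ker_le`). Together with (iv) this gives `IsJustInfiniteFrattini`.

What remains is to replace normalization by F with normalization by any open subgroup
(`isOpen_of_isOpen_le_normalizer`). Let L be normal in an open normal H ≤ F, and let K ≤ L be a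
minimal nontrivial intersection of O-conjugates of L. Since F consists of nongenerators of O, either
O normalizes K, so K is open, or some g in O lies outside N_O(K)F. In the latter case the
F-conjugates of K commute with the conjugates of K by gF, both families generate subgroups that are
dense in open ones, and F is virtually abelian (`isOpen_or_exists_abelian`).

In the virtually abelian case let B ≤ F be open, normal and abelian. It is torsion-free, O acts on
it through a finite p-group P, and the image Q of F lies in Φ(P) and acts irreducibly. Schur's lemma
forbids normal planes in P, which forces Φ(P) ≤ ⟨c^p⟩ and hence Q = ⟨e^p⟩. If Q ≠ 1, the image of
e^p − 1 has index dividing p, although e^p − 1 is the product of the two nonsurjective maps e − 1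
and 1 + e + ... + e^(p−1). So Q = 1 and F centralizes B (`commute_of_abelian`), which settles this
case.

From the group to the system. In a hereditarily just infinite virtually pro-p group, open pro-p
subgroups have open Frattini subgroups (`exists_nongenerating`), and compactness gives an obliquity
property (`exists_le_of_not_le`). Alternating the two yields open normal subgroups U_n > U_{n+1} ≥
N_n ≥ U_{n+2}; the system is G_n = G/N_n with A_n = U_n/N_n. -/

set_option linter.unusedSectionVars false

open Subgroup

/-! ### Finite p-groups without normal planes have small Frattini subgroup. -/

section FinitePGroup

variable {p : ℕ} [Fact p.Prime] {P : Type*} [Group P] [Finite P]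

omit [Finite P] in
theorem frattini_le_of_index_dvd_prime {H : Subgroup P} (hH : H.index ∣ p) : frattini P ≤ H := by
  have hp : p.Prime := Fact.out
  rcases (Nat.dvd_prime hp).1 hH with h | h
  · rw [Subgroup.index_eq_one.1 h]; exact le_top
  · refine frattini_le_coatom ⟨?_, fun K hK => ?_⟩
    · rintro rfl
      rw [Subgroup.index_top] at h
      exact hp.one_lt.ne h
    · have h1 := Subgroup.relIndex_mul_index hK.le
      rw [h] at h1
      rcases (Nat.dvd_prime hp).1 (Dvd.intro_left _ h1) with h2 | h2
      · exact Subgroup.index_eq_one.1 h2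
      · rw [h2] at h1
        have h3 : H.relIndex K = 1 := by
          have := hp.pos
          nlinarith
        exact absurd (Subgroup.relIndex_eq_one.1 h3) (not_le_of_gt hK)

theorem IsPGroup.exists_mem_center_orderOf_eq (hP : IsPGroup p P) (N : Subgroup P) [N.Normal]
    (hN : N ≠ ⊥) : ∃ h ∈ N, h ∈ center P ∧ orderOf h = p := by
  have hp : p.Prime := Fact.out
  have hQ : IsPGroup p (ConjAct P) := hP.of_equiv ConjAct.toConjAct
  have hd : p ∣ Nat.card N := by
    rcases (hP.to_subgroup N).card_eq_or_dvd with h | h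
    · exact absurd (Subgroup.card_eq_one.1 h) hN
    · exact h
  have h1 : (1 : N) ∈ MulAction.fixedPoints (ConjAct P) N := by
    intro g; exact smul_one g
  obtain ⟨b, hb, hb1⟩ := hQ.exists_fixed_point_of_prime_dvd_card_of_fixed_point N hd h1
  have hbc : (b : P) ∈ center P := by
    rw [mem_center_iff]
    intro g
    have := congrArg (Subtype.val) (hb (ConjAct.toConjAct g))
    rw [ConjAct.Subgroup.val_conj_smul, ConjAct.toConjAct_smul] at this
    exact mul_inv_eq_iff_eq_mul.1 this
  have hb1' : (b : P) ≠ 1 := by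
    intro h; exact hb1 (Subtype.ext h.symm)
  obtain ⟨k, hk⟩ := IsPGroup.iff_orderOf.1 hP (b : P)
  have hk0 : k ≠ 0 := by
    rintro rfl
    rw [pow_zero, orderOf_eq_one_iff] at hk
    exact hb1' hk
  obtain ⟨m, rfl⟩ := Nat.exists_eq_succ_of_ne_zero hk0
  refine ⟨(b : P) ^ p ^ m, N.pow_mem b.2 _, (center P).pow_mem hbc _, ?_⟩
  rw [orderOf_pow_of_dvd (pow_ne_zero _ hp.ne_zero) (by rw [hk]; exact pow_dvd_pow _ (Nat.le_succ m)),
    hk, Nat.pow_succ, Nat.mul_div_cancel_left _ (pow_pos hp.pos m)]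

/-- The image of N in P/A is a nontrivial normal subgroup, so it meets the centre in an element of
order p. -/
theorem IsPGroup.exists_central_mod (hP : IsPGroup p P) (A N : Subgroup P) [A.Normal] [N.Normal]
    (hAN : ¬ N ≤ A) : ∃ h ∈ N, h ∉ A ∧ h ^ p ∈ A ∧ ∀ g, g * h * g⁻¹ * h⁻¹ ∈ A := by
  have hQ : IsPGroup p (P ⧸ A) := hP.to_quotient A
  have hne : N.map (QuotientGroup.mk' A) ≠ ⊥ := by
    intro h
    rw [Subgroup.map_eq_bot_iff, QuotientGroup.ker_mk'] at h
    exact hAN h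
  have : (N.map (QuotientGroup.mk' A)).Normal :=
    Subgroup.Normal.map inferInstance _ (QuotientGroup.mk'_surjective A)
  obtain ⟨_, ⟨h, hh, rfl⟩, hc, ho⟩ := hQ.exists_mem_center_orderOf_eq (N.map (QuotientGroup.mk' A)) hne
  refine ⟨h, hh, ?_, ?_, fun g => ?_⟩
  · intro hA
    have : QuotientGroup.mk' A h = 1 := (QuotientGroup.eq_one_iff h).2 hA
    rw [this, orderOf_one] at ho
    exact (Fact.out : p.Prime).one_lt.ne ho
  · rw [← QuotientGroup.eq_one_iff, QuotientGroup.mk_pow]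
    change (QuotientGroup.mk' A h) ^ p = 1
    rw [← ho]; exact pow_orderOf_eq_one _
  · rw [← QuotientGroup.eq_one_iff]
    have := mem_center_iff.1 hc (QuotientGroup.mk' A g)
    change QuotientGroup.mk' A (g * h * g⁻¹ * h⁻¹) = 1
    rw [map_mul, map_mul, map_mul, this, map_inv, map_inv]
    group

theorem IsPGroup.card_quotient_of_isCoatom (hP : IsPGroup p P) {M : Subgroup P} (hM : IsCoatom M) :
    M.Normal ∧ M.index = p := by
  have hp : p.Prime := Fact.out
  have := hP.isNilpotent
  have hn : M.Normal := (Group.normalizerCondition_of_isNilpotent (G := P)).normal_of_coatom _ hM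
  refine ⟨hn, ?_⟩
  obtain ⟨h, -, hh, hp', hc⟩ := hP.exists_central_mod M ⊤ (fun h => hM.1 (top_le_iff.1 h))
  have hcy : ∀ q : P ⧸ M, q ∈ zpowers (QuotientGroup.mk' M h) := by
    have : (zpowers (QuotientGroup.mk' M h)).comap (QuotientGroup.mk' M) = ⊤ := by
      apply hM.2
      refine lt_of_le_of_ne ?_ ?_
      · intro m hm
        rw [Subgroup.mem_comap, (QuotientGroup.eq_one_iff m).2 hm |> (id : _ → QuotientGroup.mk' M m = 1)]
        exact one_mem _
      · intro e
        apply hh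
        rw [e]
        exact mem_zpowers _
    intro q
    obtain ⟨g, rfl⟩ := QuotientGroup.mk'_surjective M q
    have : g ∈ (⊤ : Subgroup P) := trivial
    rw [← ‹_ = ⊤›] at this
    exact this
  have ho : orderOf (QuotientGroup.mk' M h) = p := by
    refine orderOf_eq_prime ?_ ?_
    · rw [← map_pow]; exact (QuotientGroup.eq_one_iff _).2 hp'
    · intro e; exact hh ((QuotientGroup.eq_one_iff _).1 e)
  rw [Subgroup.index, ← ho, orderOf_eq_card_of_forall_mem_zpowers hcy]

theorem IsPGroup.pow_mem_frattini (hP : IsPGroup p P) (g : P) : g ^ p ∈ frattini P := by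
  rw [frattini, Order.radical]
  simp only [Subgroup.mem_iInf]
  intro M hM
  obtain ⟨hn, hi⟩ := hP.card_quotient_of_isCoatom hM
  rw [← hi]
  exact Subgroup.pow_index_mem M g

theorem IsPGroup.commutator_mem_frattini (hP : IsPGroup p P) (g h : P) :
    g * h * g⁻¹ * h⁻¹ ∈ frattini P := by
  rw [frattini, Order.radical]
  simp only [Subgroup.mem_iInf]
  intro M hM
  obtain ⟨hn, hi⟩ := hP.card_quotient_of_isCoatom hM
  have : Nat.card (P ⧸ M) = p := hi
  have := isCyclic_of_prime_card this
  have hc : ∀ a b : P ⧸ M, a * b = b * a := fun a b => by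
    obtain ⟨g, hg⟩ := IsCyclic.exists_generator (α := P ⧸ M)
    obtain ⟨i, rfl⟩ := hg a
    obtain ⟨j, rfl⟩ := hg b
    exact ((Commute.refl g).zpow_left i).zpow_right j
  rw [← QuotientGroup.eq_one_iff]
  change QuotientGroup.mk' M (g * h * g⁻¹ * h⁻¹) = 1
  rw [map_mul, map_mul, map_mul, map_inv, map_inv, hc (QuotientGroup.mk' M g)]
  group

/-- The norm of y under h appears as an exponent; this shows which y turns h into an element y h of
order p. -/
theorem mul_pow_of_conj_eq_pow {G : Type*} [Group G] {y h : G} {l : ℕ} (hl : h * y * h⁻¹ = y ^ l)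
    (n : ℕ) : (y * h) ^ n = y ^ (∑ i ∈ Finset.range n, l ^ i) * h ^ n := by
  induction n with
  | zero => simp
  | succ n ih =>
    have key : ∀ m : ℕ, h * y ^ m = y ^ (l * m) * h := by
      intro m
      rw [pow_mul, ← hl, conj_pow]; group
    rw [pow_succ', ih, geom_sum_succ, pow_succ' h, pow_add, pow_one]
    rw [mul_assoc y h, ← mul_assoc h, key]
    have : Commute y (y ^ (l * ∑ i ∈ Finset.range n, l ^ i)) := Commute.self_pow _ _
    rw [← this.eq]
    simp only [mul_assoc]

/-- Every normal subgroup of prime order `p` contains all elements of order `p` that are central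
modulo it, i.e. there is no noncyclic normal elementary abelian subgroup of order `p²`. -/
def HasNoNormalPlane (p : ℕ) (P : Type*) [Group P] : Prop :=
  ∀ U : Subgroup P, U.Normal → Nat.card U = p → ∀ h : P, h ^ p = 1 →
    (∀ g, g * h * g⁻¹ * h⁻¹ ∈ U) → h ∈ U

/-- Take ⟨x⟩ ≤ N cyclic, normal in P, of largest order, and h in N outside ⟨x⟩ of order p and
central modulo ⟨x⟩. Maximality makes h^p a p-th power in ⟨x⟩. As the norm is p times a unit, some y
in ⟨x⟩ gives (y h)^p = 1, and y h together with the subgroup of order p of ⟨x⟩ spans a normal plane.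
-/
theorem IsPGroup.exists_zpowers_eq (hP : IsPGroup p P) (hE : HasNoNormalPlane p P)
    (N : Subgroup P) [N.Normal]
    (hN : ∀ x : P, (zpowers x).Normal → ∀ h ∈ N, ∃ l : ℕ, h * x * h⁻¹ = x ^ l ∧
      ∃ w : ℕ, p.Coprime w ∧ ∑ i ∈ Finset.range p, l ^ i = p * w) :
    ∃ x, zpowers x = N := by
  have hp : p.Prime := Fact.out
  obtain ⟨x, ⟨hxn, hxN⟩, hmax⟩ := Set.exists_max_image {x : P | (zpowers x).Normal ∧ zpowers x ≤ N}
    orderOf (Set.toFinite _) ⟨1, by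
      rw [Set.mem_ofPred_eq, zpowers_one_eq_bot]; exact ⟨inferInstance, bot_le⟩⟩
  refine ⟨x, le_antisymm hxN ?_⟩
  by_contra hcon
  obtain ⟨h, hhN, hhA, hhp, hhc⟩ := hP.exists_central_mod (zpowers x) N hcon
  -- the subgroup generated by `x` is not contained in the one generated by such an element
  have hbig : ¬ x ∈ zpowers h := by
    intro hx
    have hle : zpowers x ≤ zpowers h := by rwa [zpowers_le]
    have hnorm : (zpowers h).Normal := by
      refine ⟨?_⟩
      rintro _ ⟨m, rfl⟩ g
      have h1 : g * h * g⁻¹ ∈ zpowers h := by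
        have := mul_mem (hle (hhc g)) (mem_zpowers h)
        simpa using this
      have := zpow_mem h1 m
      rwa [conj_zpow] at this
    have h2 := hmax h ⟨hnorm, by rwa [zpowers_le]⟩
    have h3 : Nat.card (zpowers h) ≤ Nat.card (zpowers x) := by
      rwa [Nat.card_zpowers, Nat.card_zpowers]
    have h4 := Subgroup.eq_of_le_of_card_ge hle h3
    exact hhA (h4 ▸ mem_zpowers h)
  have hx1 : x ≠ 1 := by
    rintro rfl
    exact hbig (one_mem _)
  obtain ⟨k, hk⟩ := IsPGroup.iff_orderOf.1 hP x
  have hk0 : k ≠ 0 := by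
    rintro rfl
    rw [pow_zero, orderOf_eq_one_iff] at hk
    exact hx1 hk
  obtain ⟨m, rfl⟩ := Nat.exists_eq_succ_of_ne_zero hk0
  obtain ⟨i, hi⟩ := (mem_powers_iff_mem_zpowers.2 hhp : h ^ p ∈ Submonoid.powers x)
  simp only at hi
  have hpi : p ∣ i := by
    by_contra hpi
    apply hbig
    have hco : p.Coprime i := (Nat.Prime.coprime_iff_not_dvd hp).2 hpi
    have h1 : (hP.powEquiv hco) x = h ^ p := by rw [IsPGroup.powEquiv_apply, hi]
    have h2 : x = (hP.powEquiv hco).symm (h ^ p) := by rw [← h1, Equiv.symm_apply_apply]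
    rw [h2, IsPGroup.powEquiv_symm_apply]
    exact zpow_mem (pow_mem (mem_zpowers h) _) _
  obtain ⟨i', rfl⟩ := hpi
  obtain ⟨l, hl, w, hw, hs⟩ := hN x hxn h hhN
  have hlA : ∀ y ∈ zpowers x, h * y * h⁻¹ = y ^ l := by
    rintro _ ⟨t, rfl⟩
    simp only
    rw [← conj_zpow, hl, ← zpow_natCast, ← zpow_natCast, zpow_comm]
  obtain ⟨y, hyx, hyw⟩ : ∃ y ∈ zpowers x, y ^ w = (x ^ i')⁻¹ := by
    refine ⟨(hP.powEquiv hw).symm (x ^ i')⁻¹, ?_, ?_⟩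
    · rw [IsPGroup.powEquiv_symm_apply]
      exact zpow_mem (inv_mem (pow_mem (mem_zpowers x) _)) _
    · rw [← IsPGroup.powEquiv_apply hP hw, Equiv.apply_symm_apply]
  have hyh : (y * h) ^ p = 1 := by
    rw [mul_pow_of_conj_eq_pow (hlA y hyx), hs, mul_comm p w, pow_mul, hyw, ← hi, inv_pow, ← pow_mul,
      mul_comm i' p, inv_mul_cancel]
  set U : Subgroup P := zpowers (x ^ p ^ m) with hU
  have hUmem : ∀ u, u ∈ U ↔ u ∈ zpowers x ∧ u ^ p = 1 := by
    intro u
    constructor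
    · rintro ⟨t, rfl⟩
      refine ⟨zpow_mem (pow_mem (mem_zpowers x) _) _, ?_⟩
      simp only
      rw [← zpow_natCast, zpow_comm, zpow_natCast, ← pow_mul, ← pow_succ, ← hk, pow_orderOf_eq_one,
        one_zpow]
    · rintro ⟨hu, hup⟩
      obtain ⟨t, rfl⟩ := (mem_powers_iff_mem_zpowers.2 hu : u ∈ Submonoid.powers x)
      simp only at hup ⊢
      rw [← pow_mul, ← orderOf_dvd_iff_pow_eq_one, hk, pow_succ] at hup
      obtain ⟨s, hs⟩ := Nat.dvd_of_mul_dvd_mul_right hp.pos hup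
      rw [hs, pow_mul]
      exact pow_mem (mem_zpowers _) _
  have hUn : U.Normal := by
    refine ⟨fun u hu g => ?_⟩
    rw [hUmem] at hu ⊢
    refine ⟨hxn.conj_mem _ hu.1 g, ?_⟩
    rw [conj_pow, hu.2]; group
  have hUc : Nat.card U = p := by
    rw [hU, Nat.card_zpowers, orderOf_pow_of_dvd (pow_ne_zero _ hp.ne_zero)
      (by rw [hk]; exact pow_dvd_pow _ (Nat.le_succ m)), hk, Nat.pow_succ,
      Nat.mul_div_cancel_left _ (pow_pos hp.pos m)]
  have hfin : y * h ∈ U := by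
    refine hE U hUn hUc _ hyh fun g => ?_
    have hmem : g * (y * h) * g⁻¹ * (y * h)⁻¹ ∈ zpowers x := by
      have e : g * (y * h) * g⁻¹ * (y * h)⁻¹ = (g * y * g⁻¹) * (g * h * g⁻¹ * h⁻¹) * y⁻¹ := by group
      rw [e]
      exact mul_mem (mul_mem (hxn.conj_mem _ hyx g) (hhc g)) (inv_mem hyx)
    rw [hUmem]
    refine ⟨hmem, ?_⟩
    set v := g * (y * h) * g⁻¹ * (y * h)⁻¹ with hv
    have hve : v * y * h = g * (y * h) * g⁻¹ := by rw [hv]; group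
    have h1 : (v * y * h) ^ p = 1 := by rw [hve, conj_pow, hyh]; group
    have hvy : Commute v y := by
      obtain ⟨a, rfl⟩ := hyx
      obtain ⟨b, hb⟩ := hmem
      rw [← hb]
      exact ((Commute.refl x).zpow_left _).zpow_right _
    rw [mul_pow_of_conj_eq_pow (hlA _ (mul_mem hmem hyx)), hvy.mul_pow, mul_assoc,
      ← mul_pow_of_conj_eq_pow (hlA _ hyx), hyh, mul_one, hs, pow_mul] at h1
    apply (hP.powEquiv hw).injective
    rw [IsPGroup.powEquiv_apply, IsPGroup.powEquiv_apply, h1, one_pow]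
  apply hhA
  have := mul_mem (inv_mem hyx) ((hUmem _).1 hfin).1
  simpa using this

theorem conj_pow_iterate {G : Type*} [Group G] {x h : G} {l : ℕ} (hl : h * x * h⁻¹ = x ^ l)
    (n : ℕ) : h ^ n * x * (h ^ n)⁻¹ = x ^ l ^ n := by
  induction n with
  | zero => simp
  | succ n ih =>
    have e : h ^ (n + 1) * x * (h ^ (n + 1))⁻¹ = h ^ n * (h * x * h⁻¹) * (h ^ n)⁻¹ := by
      rw [pow_succ]; group
    rw [e, hl, ← conj_pow, ih, ← pow_mul, pow_succ]

theorem IsPGroup.exists_conj_eq_pow (hP : IsPGroup p P) {x : P} (hx : (zpowers x).Normal) (h : P) :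
    ∃ t : ℕ, h * x * h⁻¹ = x ^ (1 + p * t) := by
  have hp : p.Prime := Fact.out
  by_cases hx1 : x = 1
  · exact ⟨0, by simp [hx1]⟩
  obtain ⟨l, hl⟩ := (mem_powers_iff_mem_zpowers.2 (hx.conj_mem x (mem_zpowers x) h) :
    h * x * h⁻¹ ∈ Submonoid.powers x)
  simp only at hl
  obtain ⟨n, hn⟩ := hP h
  have h1 := conj_pow_iterate hl.symm (p ^ n)
  rw [hn, one_mul, inv_one, mul_one] at h1
  have h2 : 1 ≡ l ^ p ^ n [MOD p] :=
    (pow_eq_pow_iff_modEq.1 ((pow_one x).trans h1)).of_dvd (hP.dvd_orderOf hx1)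
  have h3 : ((1 : ℕ) : ZMod p) = ((l ^ p ^ n : ℕ) : ZMod p) := (ZMod.natCast_eq_natCast_iff _ _ _).2 h2
  -- By Fermat, l ^ p ^ n = l modulo p, so l itself is 1 modulo p.
  rw [Nat.cast_pow, ZMod.pow_card_pow, ZMod.natCast_eq_natCast_iff] at h3
  have h4 : 1 ≤ l := by
    rcases Nat.eq_zero_or_pos l with rfl | h
    · have := (Nat.modEq_zero_iff_dvd.1 h3)
      exact absurd (Nat.dvd_one.1 this) hp.one_lt.ne'
    · exact h
  obtain ⟨t, ht⟩ := (Nat.modEq_iff_dvd' h4).1 h3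
  exact ⟨t, by rw [← hl]; congr 1; omega⟩

/-- Modulo p² the i-th term is 1 + i p t, and the sum of the i below p is divisible by p because p
is odd; so the total is p modulo p². -/
theorem exists_geom_sum_eq_of_odd {p : ℕ} (hp : Odd p) (t : ℕ) :
    ∃ w : ℕ, p.Coprime w ∧ ∑ i ∈ Finset.range p, (1 + p * t) ^ i = p * w := by
  have h1 : ∀ i : ℕ, ∃ c : ℕ, (1 + p * t) ^ i = 1 + i * p * t + p ^ 2 * c := by
    intro i
    induction i with
    | zero => exact ⟨0, by simp⟩
    | succ i ih =>
      obtain ⟨c, hc⟩ := ih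
      exact ⟨c + i * t ^ 2 + c * p * t, by rw [pow_succ, hc]; ring⟩
  choose c hc using h1
  obtain ⟨r, hr⟩ := hp
  have h2 : ∑ i ∈ Finset.range p, i = p * r := by
    have := Finset.sum_range_id_mul_two p
    have h3 : p - 1 = 2 * r := by omega
    rw [h3] at this
    nlinarith
  refine ⟨1 + p * (r * t + ∑ i ∈ Finset.range p, c i), by simp, ?_⟩
  calc ∑ i ∈ Finset.range p, (1 + p * t) ^ i
      = ∑ i ∈ Finset.range p, (1 + i * (p * t) + p ^ 2 * c i) := by
        refine Finset.sum_congr rfl fun i _ => ?_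
        rw [hc]; ring
    _ = p + (p * r) * (p * t) + p ^ 2 * ∑ i ∈ Finset.range p, c i := by
        rw [Finset.sum_add_distrib, Finset.sum_add_distrib, ← Finset.sum_mul, h2, ← Finset.mul_sum]
        simp
    _ = _ := by ring

-- The quotient by M has exponent 2, so x in M⟨y⟩ and x not in M force x and y into the same coset:
-- there is only one nontrivial coset.
omit [Finite P] in
theorem index_dvd_two_of_forall_mem_sup {M : Subgroup P} (hM : ∀ g : P, g ^ 2 ∈ M) {x : P}
    (hx : x ∉ M) (hmax : ∀ y ∉ M, x ∈ M ⊔ zpowers y) : M.index = 2 := by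
  have hn : M.Normal := by
    refine ⟨fun m hm g => ?_⟩
    have e : g * m * g⁻¹ = (g * m) ^ 2 * m⁻¹ * (g ^ 2)⁻¹ := by simp only [pow_two]; group
    rw [e]
    exact mul_mem (mul_mem (hM _) (inv_mem hm)) (inv_mem (hM _))
  rw [Subgroup.index_eq_two_iff]
  refine ⟨x, fun b => ?_⟩
  by_cases hb : b ∈ M
  · exact Or.inr ⟨hb, fun h => hx ((Subgroup.mul_mem_cancel_left M hb).1 h)⟩
  · refine Or.inl ⟨?_, hb⟩
    obtain ⟨m, hm, _, ⟨t, rfl⟩, e⟩ := Subgroup.mem_sup_of_normal_left.1 (hmax b hb)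
    simp only at e
    rcases Int.even_or_odd' t with ⟨s, rfl | rfl⟩
    · exfalso
      apply hx
      rw [← e, zpow_mul]
      exact mul_mem hm (zpow_mem (by exact_mod_cast hM b) _)
    · have e2 : b * x = (b * m * b⁻¹) * (b ^ 2) ^ (s + 1) := by
        rw [← e, ← zpow_natCast, ← zpow_mul]
        have : b * (m * b ^ (2 * s + 1)) = b * m * b⁻¹ * (b * b ^ (2 * s + 1)) := by group
        rw [this, ← zpow_one_add]
        congr 2
        push_cast; ring
      rw [e2]
      exact mul_mem (hn.conj_mem _ hm _) (zpow_mem (hM b) _)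

theorem frattini_le_closure_squares (P : Type*) [Group P] [Finite P] :
    frattini P ≤ closure (Set.range fun g : P => g ^ 2) := by
  intro x hx
  by_contra hcon
  obtain ⟨M, -, ⟨hM, hxM⟩, hmax⟩ := (Set.toFinite {M : Subgroup P |
    closure (Set.range fun g : P => g ^ 2) ≤ M ∧ x ∉ M}).exists_le_maximal ⟨le_rfl, hcon⟩
  have hi := index_dvd_two_of_forall_mem_sup (M := M) (fun g => hM (subset_closure ⟨g, rfl⟩)) hxM ?_
  · exact hxM (frattini_le_of_index_dvd_prime (p := 2) hi.dvd hx)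
  · intro y hy
    by_contra hxy
    have := hmax ⟨hM.trans le_sup_left, hxy⟩ le_sup_left
    exact hy (this (mem_sup_right (mem_zpowers y)))

/-- A finite `p`-group without noncyclic normal subgroups of order `p²` and exponent `p` has a
cyclic Frattini subgroup, contained in the group generated by a `p`-th power. -/
theorem IsPGroup.exists_frattini_le_zpowers (hP : IsPGroup p P) (hE : HasNoNormalPlane p P) :
    ∃ c : P, frattini P ≤ zpowers (c ^ p) := by
  have hp : p.Prime := Fact.out
  rcases hp.eq_two_or_odd' with rfl | hodd
  · have hsq : (closure (Set.range fun g : P => g ^ 2)).Normal := by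
      refine ⟨fun n hn g => ?_⟩
      have hle : closure (Set.range fun g : P => g ^ 2) ≤
          (closure (Set.range fun g : P => g ^ 2)).comap (MulAut.conj g).toMonoidHom := by
        rw [closure_le]
        rintro _ ⟨h, rfl⟩
        exact subset_closure ⟨g * h * g⁻¹, by simp [conj_pow]⟩
      exact hle hn
    -- For p = 2 the norm 1 + l is twice an odd number only if l is 1 modulo 4. Squares act with
    -- such exponents, since (1 + 2t)² = 1 + 4(t + t²), so the cyclicity criterion is applied to the
    -- subgroup they generate.
    obtain ⟨x, hx⟩ := hP.exists_zpowers_eq hE (closure (Set.range fun g : P => g ^ 2)) (by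
      intro x hxn h hh
      have hpow : ∀ g : P, ∀ t : ℕ, g * x * g⁻¹ = x ^ (1 + 4 * t) → ∀ n : ℕ, ∃ t' : ℕ,
          g ^ n * x * (g ^ n)⁻¹ = x ^ (1 + 4 * t') := by
        intro g t ht n
        have : 1 ≡ (1 + 4 * t) ^ n [MOD 4] := by
          have : 1 + 4 * t ≡ 1 [MOD 4] := by simp [Nat.ModEq]
          simpa using (this.pow n).symm
        obtain ⟨t', ht'⟩ := (Nat.modEq_iff_dvd' (Nat.one_le_pow _ _ (by omega))).1 this
        refine ⟨t', ?_⟩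
        rw [conj_pow_iterate ht, ← ht']
        congr 1
        have := Nat.one_le_pow n (1 + 4 * t) (by omega)
        omega
      have key : ∃ t : ℕ, h * x * h⁻¹ = x ^ (1 + 4 * t) := by
        induction hh using closure_induction with
        | mem g hg =>
          obtain ⟨g, rfl⟩ := hg
          obtain ⟨t, ht⟩ := hP.exists_conj_eq_pow hxn g
          refine ⟨t + t ^ 2, ?_⟩
          simp only
          rw [conj_pow_iterate ht]
          congr 1; ring
        | one => exact ⟨0, by simp⟩
        | mul a b _ _ ha hb =>
          obtain ⟨s, hs⟩ := ha
          obtain ⟨t, ht⟩ := hb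
          refine ⟨s + t + 4 * s * t, ?_⟩
          have e : a * b * x * (a * b)⁻¹ = a * (b * x * b⁻¹) * a⁻¹ := by group
          rw [e, ht, ← conj_pow, hs, ← pow_mul]
          congr 1; ring
        | inv a _ ha =>
          obtain ⟨t, ht⟩ := ha
          obtain ⟨n, hn⟩ : ∃ n : ℕ, a ^ n = a⁻¹ :=
            (mem_powers_iff_mem_zpowers.2 (inv_mem (mem_zpowers a)) : a⁻¹ ∈ Submonoid.powers a)
          rw [← hn]
          exact hpow a t ht n
      obtain ⟨t, ht⟩ := key
      refine ⟨_, ht, 1 + 2 * t, by simp, ?_⟩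
      rw [Finset.sum_range_succ, Finset.sum_range_one]
      ring)
    suffices h : ∃ c : P, x ∈ zpowers (c ^ 2) by
      obtain ⟨c, hc⟩ := h
      refine ⟨c, (frattini_le_closure_squares P).trans ?_⟩
      rw [← hx, zpowers_le]
      exact hc
    -- If x lies in no ⟨c²⟩, every square is an even power of x, so ⟨x⟩ ≤ ⟨x²⟩, and c = x is a
    -- contradiction.
    by_contra hcon
    push Not at hcon
    apply hcon x
    have hle : closure (Set.range fun g : P => g ^ 2) ≤ zpowers (x ^ 2) := by
      rw [closure_le]
      rintro _ ⟨c, rfl⟩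
      have hc : c ^ 2 ∈ zpowers x := hx ▸ subset_closure ⟨c, rfl⟩
      obtain ⟨i, hi⟩ := (mem_powers_iff_mem_zpowers.2 hc : c ^ 2 ∈ Submonoid.powers x)
      simp only at hi ⊢
      have h2i : 2 ∣ i := by
        by_contra h2i
        apply hcon c
        have hco : Nat.Coprime 2 i := (Nat.Prime.coprime_iff_not_dvd hp).2 h2i
        have h1 : (hP.powEquiv hco) x = c ^ 2 := by rw [IsPGroup.powEquiv_apply, hi]
        have h2 : x = (hP.powEquiv hco).symm (c ^ 2) := by rw [← h1, Equiv.symm_apply_apply]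
        rw [h2, IsPGroup.powEquiv_symm_apply]
        exact zpow_mem (mem_zpowers _) _
      obtain ⟨j, rfl⟩ := h2i
      rw [SetLike.mem_coe, ← hi, pow_mul]
      exact pow_mem (mem_zpowers _) _
    exact hle (hx ▸ mem_zpowers x)
  -- For odd p all exponents 1 + p t satisfy the norm condition, so P itself is cyclic.
  · obtain ⟨x, hx⟩ := hP.exists_zpowers_eq hE ⊤ (by
      intro x hxn h _
      obtain ⟨t, ht⟩ := hP.exists_conj_eq_pow hxn h
      exact ⟨_, ht, exists_geom_sum_eq_of_odd hodd t⟩)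
    refine ⟨x, frattini_le_of_index_dvd_prime (p := p) ?_⟩
    have hc : Nat.card P = orderOf x := by
      rw [← Nat.card_zpowers, hx, Subgroup.card_top]
    have h1 := Subgroup.index_mul_card (zpowers (x ^ p))
    rw [Nat.card_zpowers, hc] at h1
    obtain ⟨k, hk⟩ := IsPGroup.iff_orderOf.1 hP x
    rcases k with _ | m
    · rw [hk, pow_zero] at h1
      rw [Nat.eq_one_of_mul_eq_one_right h1]
      exact one_dvd _
    · rw [orderOf_pow_of_dvd hp.ne_zero (by rw [hk]; exact dvd_pow_self _ (Nat.succ_ne_zero m)), hk,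
        pow_succ, Nat.mul_div_cancel _ hp.pos, mul_comm] at h1
      rw [Nat.eq_of_mul_eq_mul_left (pow_pos hp.pos m) h1]

end FinitePGroup

/-! ### Irreducible actions of finite p-groups on torsion-free topological abelian groups. -/

section LatticeAction

variable {V : Type*} [AddCommGroup V] [TopologicalSpace V] [IsTopologicalAddGroup V]

/-- The additive endomorphism underlying a continuous one. -/
def ContinuousLinearMap.toAddEnd (r : V →L[ℤ] V) : V →+ V := (r : V →ₗ[ℤ] V).toAddMonoidHom

@[simp] theorem ContinuousLinearMap.toAddEnd_apply (r : V →L[ℤ] V) (v : V) : r.toAddEnd v = r v := rfl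

/-- Every nontrivial closed subgroup of `V` invariant under the endomorphisms in `S` has finite
index. -/
def IsTopologicallyIrreducible (S : Set (V →L[ℤ] V)) : Prop :=
  ∀ W : AddSubgroup V, IsClosed (W : Set V) → W ≠ ⊥ → (∀ r ∈ S, ∀ w ∈ W, r w ∈ W) → W.FiniteIndex

/-- Schur's lemma: the kernel of r is closed and invariant, so it is trivial or of some finite index
m; in the second case r kills mV, and torsion-freeness gives r = 0. -/
theorem IsTopologicallyIrreducible.eq_zero_or_injective [T1Space V] {S : Set (V →L[ℤ] V)}
    (hS : IsTopologicallyIrreducible S) (htf : ∀ n : ℕ, n ≠ 0 → ∀ v : V, n • v = 0 → v = 0)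
    {r : V →L[ℤ] V} (hr : ∀ s ∈ S, Commute r s) : r = 0 ∨ ∀ v, r v = 0 → v = 0 := by
  by_cases h : r.toAddEnd.ker = ⊥
  · exact Or.inr fun v hv => (AddSubgroup.mem_bot.1 (h ▸ (show v ∈ r.toAddEnd.ker from hv)))
  · left
    have hfi : r.toAddEnd.ker.FiniteIndex := by
      refine hS _ ?_ h ?_
      · exact isClosed_singleton.preimage (r.continuous)
      · intro s hs w hw
        have h1 : (r * s) w = (s * r) w := by rw [(hr s hs).eq]
        have h2 : r w = 0 := hw
        change r (s w) = 0
        rw [mul_apply_eq_comp, mul_apply_eq_comp, h2, map_zero] at h1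
        exact h1
    ext v
    have h1 : r (r.toAddEnd.ker.index • v) = 0 := r.toAddEnd.ker.nsmul_index_mem v
    rw [map_nsmul] at h1
    exact htf _ hfi.index_ne_zero _ h1

/-- A proper subgroup containing `pV` on whose quotient the `p`-power-torsion automorphism `ε` of `V`
has a nonzero fixed vector. -/
theorem exists_fixed_mod {p : ℕ} (hp : p.Prime) (ε : V →L[ℤ] V) {n : ℕ} (hε : ε ^ p ^ n = 1)
    {V₁ : AddSubgroup V} (hfi : V₁.FiniteIndex) (hV₁ : V₁ ≠ ⊤) {k : ℕ} (hk : ∀ v, p ^ k • v ∈ V₁)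
    (hinv : ∀ v ∈ V₁, ε v ∈ V₁) :
    ∃ V₂ : AddSubgroup V, V₂.FiniteIndex ∧ (∀ v, p • v ∈ V₂) ∧ (∀ v ∈ V₂, ε v ∈ V₂) ∧
      ∃ v ∉ V₂, (ε - 1) v ∈ V₂ := by
  set V₂ := V₁ ⊔ (p • (1 : V →L[ℤ] V)).toAddEnd.range with hV₂
  have hmem : ∀ v, v ∈ V₂ ↔ ∃ u ∈ V₁, ∃ w, u + p • w = v := by
    intro v
    rw [hV₂, AddSubgroup.mem_sup]
    constructor
    · rintro ⟨u, hu, _, ⟨w, rfl⟩, rfl⟩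
      exact ⟨u, hu, w, by simp⟩
    · rintro ⟨u, hu, w, rfl⟩
      exact ⟨u, hu, p • w, ⟨w, by simp⟩, rfl⟩
  have hpV : ∀ v, p • v ∈ V₂ := fun v => (hmem _).2 ⟨0, V₁.zero_mem, v, zero_add _⟩
  -- As for Nakayama's lemma: V = V₁ + pV iterates to V = V₁ + p^k V = V₁.
  have hne : V₂ ≠ ⊤ := by
    intro htop
    apply hV₁
    have key : ∀ j : ℕ, ∀ v, ∃ w, v - p ^ j • w ∈ V₁ := by
      intro j
      induction j with
      | zero => intro v; exact ⟨v, by simp⟩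
      | succ j ih =>
        intro v
        obtain ⟨w, hw⟩ := ih v
        obtain ⟨u, hu, w', rfl⟩ := (hmem w).1 (htop ▸ AddSubgroup.mem_top w)
        refine ⟨w', ?_⟩
        have e : v - p ^ (j + 1) • w' = (v - p ^ j • (u + p • w')) + p ^ j • u := by
          rw [smul_add, pow_succ, mul_smul]; abel
        rw [e]
        exact V₁.add_mem hw (V₁.nsmul_mem hu _)
    rw [AddSubgroup.eq_top_iff']
    intro v
    obtain ⟨w, hw⟩ := key k v
    have := V₁.add_mem hw (hk w)
    simpa using this
  have hle : V₁ ≤ V₂ := le_sup_left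
  refine ⟨V₂, AddSubgroup.finiteIndex_of_le hle, hpV, ?_, ?_⟩
  · intro v hv
    obtain ⟨u, hu, w, rfl⟩ := (hmem v).1 hv
    rw [map_add, map_nsmul]
    exact V₂.add_mem (hle (hinv u hu)) (hpV _)
  · obtain ⟨v, hv⟩ : ∃ v, v ∉ V₂ := by
      by_contra h
      push Not at h
      exact hne ((AddSubgroup.eq_top_iff' _).2 h)
    -- Modulo p, (ε − 1)^(p^n) = ε^(p^n) − 1 = 0. So ε − 1 is nilpotent on V/V₂, and the last
    -- nonzero iterate of v is fixed.
    have hnil : ((ε - 1) ^ p ^ n) v ∈ V₂ := by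
      have h1 := (Commute.one_right (ε - 1)).add_pow_prime_pow_eq hp n
      rw [sub_add_cancel, hε, one_pow] at h1
      set S := ∑ k ∈ Finset.Ioo 0 (p ^ n), (ε - 1) ^ (k - 1) * 1 ^ (p ^ n - k - 1) *
        (((p ^ n).choose k / p : ℕ) : V →L[ℤ] V)
      have h2 : (ε - 1) ^ p ^ n = p • (-((ε - 1) * 1 * S)) := by
        rw [nsmul_eq_mul, mul_neg, ← mul_assoc, ← mul_assoc]
        rw [eq_neg_iff_add_eq_zero]
        rw [add_right_comm] at h1
        exact left_eq_add.1 (h1.trans (add_comm _ _))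
      rw [h2]
      exact hpV _
    classical
    have hex : ∃ m : ℕ, ((ε - 1) ^ m : V →L[ℤ] V) v ∈ V₂ := ⟨_, hnil⟩
    have hpos : Nat.find hex ≠ 0 := by
      intro h0
      have := Nat.find_spec hex
      rw [h0, pow_zero] at this
      exact hv this
    obtain ⟨m, hm⟩ := Nat.exists_eq_succ_of_ne_zero hpos
    refine ⟨((ε - 1) ^ m) v, Nat.find_min hex (by omega), ?_⟩
    have := Nat.find_spec hex
    rw [hm, Nat.succ_eq_add_one, pow_succ'] at this
    exact this

/-- A surjective endomorphism of the finite group V/W is injective; the proof compares the indices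
of W and its preimage. -/
theorem mem_of_surjective_of_apply_mem {r : V →L[ℤ] V} (hr : Function.Surjective r)
    {W : AddSubgroup V} (hW : W.FiniteIndex) (hinv : ∀ w ∈ W, r w ∈ W) {v : V} (hv : r v ∈ W) :
    v ∈ W := by
  have h1 : (W.comap r.toAddEnd).index = W.index := W.index_comap_of_surjective hr
  have h2 : W ≤ W.comap r.toAddEnd := hinv
  have h3 := AddSubgroup.relIndex_mul_index h2
  rw [h1] at h3
  have h4 : W.relIndex (W.comap r.toAddEnd) = 1 :=
    Nat.eq_of_mul_eq_mul_right (Nat.pos_of_ne_zero hW.index_ne_zero) (by rw [h3, one_mul])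
  exact AddSubgroup.relIndex_eq_one.1 h4 hv

theorem pow_apply_mem {ε : V →L[ℤ] V} {W : AddSubgroup V} (hinv : ∀ w ∈ W, ε w ∈ W) (i : ℕ) :
    ∀ w ∈ W, (ε ^ i) w ∈ W := by
  induction i with
  | zero => intro w hw; exact hw
  | succ i ih =>
    intro w hw
    rw [pow_succ']
    exact hinv _ (ih w hw)

theorem not_surjective_sub_one {p : ℕ} (hp : p.Prime) (ε : V →L[ℤ] V) {n : ℕ} (hε : ε ^ p ^ n = 1)
    {V₁ : AddSubgroup V} (hfi : V₁.FiniteIndex) (hV₁ : V₁ ≠ ⊤) {k : ℕ} (hk : ∀ v, p ^ k • v ∈ V₁)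
    (hinv : ∀ v ∈ V₁, ε v ∈ V₁) : ¬ Function.Surjective (ε - 1 : V →L[ℤ] V) := by
  intro hs
  obtain ⟨V₂, h1, h2, h3, v, hv, hv'⟩ := exists_fixed_mod hp ε hε hfi hV₁ hk hinv
  exact hv (mem_of_surjective_of_apply_mem hs h1 (fun w hw => V₂.sub_mem (h3 w hw) hw) hv')

/-- On a vector fixed modulo V₂ the sum acts as multiplication by p, that is, as zero. -/
theorem not_surjective_geom_sum {p : ℕ} (hp : p.Prime) (ε : V →L[ℤ] V) {n : ℕ} (hε : ε ^ p ^ n = 1)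
    {V₁ : AddSubgroup V} (hfi : V₁.FiniteIndex) (hV₁ : V₁ ≠ ⊤) {k : ℕ} (hk : ∀ v, p ^ k • v ∈ V₁)
    (hinv : ∀ v ∈ V₁, ε v ∈ V₁) : ¬ Function.Surjective (∑ i ∈ Finset.range p, ε ^ i : V →L[ℤ] V) := by
  intro hs
  obtain ⟨V₂, h1, h2, h3, v, hv, hv'⟩ := exists_fixed_mod hp ε hε hfi hV₁ hk hinv
  refine hv (mem_of_surjective_of_apply_mem hs h1 (fun w hw => ?_) ?_)
  · rw [sum_apply]
    exact V₂.sum_mem fun i _ => pow_apply_mem h3 i w hw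
  · have h4 : ∀ i : ℕ, (ε ^ i) v - v ∈ V₂ := by
      intro i
      have e : (ε ^ i) v - v = (∑ j ∈ Finset.range i, ε ^ j : V →L[ℤ] V) ((ε - 1) v) := by
        rw [← mul_apply_eq_comp, geom_sum_mul]; rfl
      rw [e, sum_apply]
      exact V₂.sum_mem fun j _ => pow_apply_mem h3 j _ hv'
    have e : (∑ i ∈ Finset.range p, ε ^ i : V →L[ℤ] V) v =
        ∑ i ∈ Finset.range p, ((ε ^ i) v - v) + p • v := by
      rw [sum_apply, Finset.sum_sub_distrib]
      simp
    rw [e]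
    exact V₂.add_mem (V₂.sum_mem fun i _ => h4 i) (h2 v)

section

variable {p : ℕ} [Fact p.Prime] {P : Type*} [Group P] [Finite P] {φ : P →* (V →L[ℤ] V)}
  {Q : Subgroup P}

-- By Schur's lemma g − 1 is injective, and it annihilates the norm because g^p = 1.
omit [Fact p.Prime] [Finite P] in
theorem IsTopologicallyIrreducible.geom_sum_eq_zero [T1Space V] (hφ : Function.Injective φ)
    (hQ : IsTopologicallyIrreducible (φ '' Q)) (htf : ∀ n : ℕ, n ≠ 0 → ∀ v : V, n • v = 0 → v = 0)
    {g : P} (hg : g ≠ 1) (hgp : g ^ p = 1) (hc : ∀ q ∈ Q, Commute g q) :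
    ∑ i ∈ Finset.range p, φ g ^ i = 0 := by
  have hne : φ g - 1 ≠ 0 := by
    intro h
    exact hg (hφ (by rw [map_one]; exact sub_eq_zero.1 h))
  have hinj : ∀ v, (φ g - 1) v = 0 → v = 0 := by
    refine (hQ.eq_zero_or_injective htf ?_).resolve_left hne
    rintro _ ⟨q, hq, rfl⟩
    exact ((hc q hq).map φ).sub_left (Commute.one_left _)
  ext v
  apply hinj
  rw [← mul_apply_eq_comp, mul_geom_sum, ← map_pow, hgp, map_one, sub_self]
  rfl

/-- A normal plane ⟨u, h⟩ would centralize Q, so all its nontrivial elements would have norm zero;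
adding up these norms gives p = 0 on V. -/
theorem IsTopologicallyIrreducible.hasNoNormalPlane [T1Space V] [Nontrivial V]
    (hP : IsPGroup p P) (hφ : Function.Injective φ)
    (hQ : IsTopologicallyIrreducible (φ '' Q)) (htf : ∀ n : ℕ, n ≠ 0 → ∀ v : V, n • v = 0 → v = 0)
    (hQf : Q ≤ frattini P) : HasNoNormalPlane p P := by
  have hp : p.Prime := Fact.out
  intro U hU hUc h hhp hhU
  by_contra hh
  have hUp : IsPGroup p U := hP.to_subgroup U
  -- `U` is central
  have hUbot : U ≠ ⊥ := by
    rintro rfl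
    rw [Subgroup.card_bot] at hUc
    exact hp.one_lt.ne hUc
  obtain ⟨u, huU, huc, huo⟩ := hP.exists_mem_center_orderOf_eq U hUbot
  have hUu : zpowers u = U := by
    refine Subgroup.eq_of_le_of_card_ge (by rwa [zpowers_le]) ?_
    rw [Nat.card_zpowers, huo, hUc]
  have hUcen : ∀ v ∈ U, ∀ g : P, g * v = v * g := by
    intro v hv g
    rw [← hUu] at hv
    obtain ⟨i, rfl⟩ := hv
    exact mem_center_iff.1 (zpow_mem huc i) g
  -- `h` commutes with `Q`
  let f : P →* U :=
    { toFun := fun g => ⟨g * h * g⁻¹ * h⁻¹, hhU g⟩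
      map_one' := by ext; simp
      map_mul' := by
        intro a b
        ext
        have e : a * b * h * (a * b)⁻¹ * h⁻¹ = a * (b * h * b⁻¹ * h⁻¹) * (h * a⁻¹ * h⁻¹) := by group
        simp only [MulMemClass.mk_mul_mk]
        rw [e, hUcen _ (hhU b)]
        have := hUcen _ (hhU b) (a * h * a⁻¹ * h⁻¹)
        rw [this]
        group }
  -- The homomorphism g ↦ [g, h] into U has kernel of index 1 or p, which therefore contains Φ(P)
  -- and Q.
  have hker : f.ker.index ∣ p := by
    rw [Subgroup.index_ker, ← hUc]
    exact Subgroup.card_subgroup_dvd_card _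
  have hcomm : ∀ q ∈ Q, Commute h q := by
    intro q hq
    have h1 : f q = 1 := frattini_le_of_index_dvd_prime hker (hQf hq)
    have h2 : q * h * q⁻¹ * h⁻¹ = 1 := congrArg Subtype.val h1
    have h3 : q * h = h * q := by
      have := mul_inv_eq_one.1 h2
      exact mul_inv_eq_iff_eq_mul.1 this
    exact h3.symm
  have hucomm : ∀ g : P, Commute u g := fun g => (mem_center_iff.1 huc g).symm
  have hsum1 : ∀ i : ℕ, ¬ p ∣ i → ∑ j ∈ Finset.range p, φ (u ^ i) ^ j = 0 := by
    intro i hi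
    refine hQ.geom_sum_eq_zero hφ htf ?_ ?_ fun q _ => (hucomm q).pow_left i
    · rwa [Ne, ← orderOf_dvd_iff_pow_eq_one, huo]
    · rw [pow_right_comm, ← huo, pow_orderOf_eq_one, one_pow]
  have hsum2 : ∀ j : ℕ, ∑ i ∈ Finset.range p, φ (u ^ j * h) ^ i = 0 := by
    intro j
    refine hQ.geom_sum_eq_zero hφ htf ?_ ?_ fun q hq => ((hucomm q).pow_left j).mul_left (hcomm q hq)
    · intro e
      apply hh
      rw [eq_inv_of_mul_eq_one_right e]
      exact inv_mem (pow_mem huU j)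
    · rw [((hucomm h).pow_left j).mul_pow, hhp, mul_one, pow_right_comm, ← huo, pow_orderOf_eq_one,
        one_pow]
  have htot : (p : V →L[ℤ] V) = 0 := by
    have h1 : ∑ j ∈ Finset.range p, ∑ i ∈ Finset.range p, φ (u ^ j * h) ^ i = 0 :=
      Finset.sum_eq_zero fun j _ => hsum2 j
    rw [Finset.sum_comm] at h1
    -- After exchanging sums, the terms with i = 0 give p, and for the other i the norm of u^i
    -- factors out.
    have h2 : ∀ i ∈ Finset.range p, ∑ j ∈ Finset.range p, φ (u ^ j * h) ^ i =
        if i = 0 then (p : V →L[ℤ] V) else 0 := by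
      intro i hi
      split_ifs with h0
      · subst h0; simp
      · have hnd : ¬ p ∣ i := fun hd =>
          absurd (Nat.le_of_dvd (Nat.pos_of_ne_zero h0) hd) (not_le.2 (Finset.mem_range.1 hi))
        rw [← zero_mul (φ h ^ i), ← hsum1 i hnd, Finset.sum_mul]
        refine Finset.sum_congr rfl fun j _ => ?_
        rw [← map_pow, ← map_pow, ← map_pow, ← map_mul, ((hucomm h).pow_left j).mul_pow,
          pow_right_comm]
    rw [Finset.sum_congr rfl h2] at h1
    simpa [hp.pos] using h1
  obtain ⟨v, hv⟩ := exists_ne (0 : V)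
  apply hv
  apply htf p hp.ne_zero
  have : (p : V →L[ℤ] V) v = 0 := by rw [htot]; rfl
  rw [← this, ← nsmul_one]
  simp

/-- If a finite `p`-group acts faithfully on a compact torsion-free abelian group and a subgroup of
its Frattini subgroup acts irreducibly, then that subgroup is trivial. -/
theorem IsTopologicallyIrreducible.eq_bot_of_le_frattini [CompactSpace V] [T2Space V]
    (hP : IsPGroup p P) (hφ : Function.Injective φ)
    (hQ : IsTopologicallyIrreducible (φ '' Q)) (htf : ∀ n : ℕ, n ≠ 0 → ∀ v : V, n • v = 0 → v = 0)
    (hQf : Q ≤ frattini P) {V₁ : AddSubgroup V} (hfi : V₁.FiniteIndex) (hV₁ : V₁ ≠ ⊤) {k : ℕ}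
    (hk : ∀ v, p ^ k • v ∈ V₁) (hinv : ∀ g, ∀ v ∈ V₁, φ g v ∈ V₁) : Q = ⊥ := by
  have hp : p.Prime := Fact.out
  have hV : Nontrivial V := by
    by_contra h
    rw [not_nontrivial_iff_subsingleton] at h
    exact hV₁ (Subsingleton.elim _ _)
  obtain ⟨c, hc⟩ := hP.exists_frattini_le_zpowers (hQ.hasNoNormalPlane hP hφ htf hQf)
  -- A generator of Q has the form (c^p)^j, so e = c^j.
  obtain ⟨e, he⟩ : ∃ e : P, Q = zpowers (e ^ p) := by
    have : IsCyclic (zpowers (c ^ p)) := inferInstance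
    have : IsCyclic (Q.subgroupOf (zpowers (c ^ p))) := inferInstance
    have : IsCyclic Q := (isCyclic_of_surjective
      (Subgroup.subgroupOfEquivOfLe (hQf.trans hc)) (MulEquiv.surjective _))
    obtain ⟨a, ha⟩ := Subgroup.isCyclic_iff_exists_zpowers_eq_top Q |>.1 this
    have haQ : a ∈ zpowers (c ^ p) := hc (hQf (ha ▸ mem_zpowers a))
    obtain ⟨j, rfl⟩ := haQ
    refine ⟨c ^ j, ?_⟩
    rw [← ha]
    simp only
    rw [← zpow_natCast, ← zpow_natCast, zpow_comm]
  by_contra hne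
  set a := e ^ p with ha
  have ha1 : a ≠ 1 := by
    intro h
    rw [h, zpowers_one_eq_bot] at he
    exact hne he
  have hcomm : ∀ g : P, Commute g a → ∀ s ∈ φ '' Q, Commute (φ g) s := by
    rintro g hg _ ⟨q, hq, rfl⟩
    rw [he] at hq
    obtain ⟨j, rfl⟩ := hq
    exact (hg.zpow_right j).map φ
  set T : V →L[ℤ] V := φ a - 1 with hT
  have hTinj : ∀ v, T v = 0 → v = 0 := by
    refine (hQ.eq_zero_or_injective htf fun s hs =>
      ((hcomm a (Commute.refl a)) s hs).sub_left (Commute.one_left _)).resolve_left ?_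
    intro h
    exact ha1 (hφ (by rw [map_one]; exact sub_eq_zero.1 h))
  obtain ⟨n, hn⟩ := hP e
  have hεn : φ e ^ p ^ n = 1 := by rw [← map_pow, hn, map_one]
  set S : V →L[ℤ] V := ∑ i ∈ Finset.range p, φ e ^ i with hS
  have hTS : T = (φ e - 1) * S := by rw [hS, mul_geom_sum, hT, ha, map_pow]
  have hTS' : T = S * (φ e - 1) := by rw [hS, geom_sum_mul, hT, ha, map_pow]
  -- the index of `T V` divides `p`
  have hidx : T.toAddEnd.range.index ∣ p := by
    obtain ⟨b, hb⟩ := exists_ne (0 : V)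
    -- B is the closed Q-submodule generated by b ≠ 0, of finite index by irreducibility. Since a
    -- acts trivially on B/TB, that quotient is generated by b, and it is killed by p.
    set C : AddSubgroup V := AddSubgroup.closure (Set.range fun i : ℕ => (φ a ^ i) b) with hC
    set B := C.topologicalClosure with hB
    have hbB : b ∈ B := C.le_topologicalClosure (AddSubgroup.subset_closure ⟨0, rfl⟩)
    have hBinv : ∀ v ∈ B, φ a v ∈ B := by
      have h1 : C ≤ B.comap (φ a).toAddEnd := by
        rw [hC, AddSubgroup.closure_le]
        rintro _ ⟨i, rfl⟩
        refine C.le_topologicalClosure (AddSubgroup.subset_closure ⟨i + 1, ?_⟩)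
        simp only [pow_succ']
        rfl
      exact C.topologicalClosure_minimal h1
        (C.isClosed_topologicalClosure.preimage (φ a).continuous)
    have hQpow : ∀ q ∈ Q, ∃ i : ℕ, a ^ i = q := by
      intro q hq
      rw [he] at hq
      exact mem_powers_iff_mem_zpowers.2 hq
    have hBfi : B.FiniteIndex := by
      refine hQ B C.isClosed_topologicalClosure ?_ ?_
      · intro h
        rw [h] at hbB
        exact hb (AddSubgroup.mem_bot.1 hbB)
      · rintro _ ⟨q, hq, rfl⟩ w hw
        obtain ⟨i, rfl⟩ := hQpow q hq
        rw [map_pow]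
        exact pow_apply_mem hBinv i w hw
    set D := B.map T.toAddEnd with hD
    have hDB : D ≤ B := by
      rintro _ ⟨v, hv, rfl⟩
      exact B.sub_mem (hBinv v hv) hv
    have hDinv : ∀ v ∈ D, φ a v ∈ D := by
      rintro _ ⟨v, hv, rfl⟩
      refine ⟨φ a v, hBinv v hv, ?_⟩
      change (T * φ a) v = (φ a * T) v
      rw [hT, sub_mul, mul_sub, one_mul, mul_one]
    have hDpow : ∀ i : ℕ, (φ a ^ i) b - b ∈ D := by
      intro i
      refine ⟨(∑ j ∈ Finset.range i, φ a ^ j : V →L[ℤ] V) b, ?_, ?_⟩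
      · rw [sum_apply]
        exact B.sum_mem fun j _ => pow_apply_mem hBinv j b hbB
      · change (T * ∑ j ∈ Finset.range i, φ a ^ j : V →L[ℤ] V) b = _
        rw [hT, mul_geom_sum]; rfl
    have hpb : p • b ∈ D := by
      obtain ⟨m, hm⟩ := IsPGroup.iff_orderOf.1 hP a
      have hm0 : m ≠ 0 := by
        rintro rfl
        rw [pow_zero, orderOf_eq_one_iff] at hm
        exact ha1 hm
      obtain ⟨m, rfl⟩ := Nat.exists_eq_succ_of_ne_zero hm0
      -- The element a^(p^m) has order p, so its norm kills b; each term of the norm sends b to b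
      -- modulo D.
      have h1 : ∑ i ∈ Finset.range p, φ (a ^ p ^ m) ^ i = 0 := by
        refine hQ.geom_sum_eq_zero hφ htf ?_ ?_ ?_
        · rw [Ne, ← orderOf_dvd_iff_pow_eq_one, hm]
          intro h
          exact absurd (Nat.pow_dvd_pow_iff_le_right hp.one_lt |>.1 h) (by omega)
        · rw [← pow_mul, ← pow_succ, ← Nat.succ_eq_add_one, ← hm, pow_orderOf_eq_one]
        · intro q hq
          obtain ⟨i, rfl⟩ := hQpow q hq
          exact (Commute.refl a).pow_pow _ _
      have h2 : ∑ i ∈ Finset.range p, ((φ a ^ (p ^ m * i)) b - b) + p • b = 0 := by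
        have h3 := congrArg (fun r : V →L[ℤ] V => r b) h1
        simp only [sum_apply] at h3
        rw [Finset.sum_sub_distrib]
        simp only [Finset.sum_const, Finset.card_range, sub_add_cancel]
        rw [← (show (0 : V →L[ℤ] V) b = 0 from rfl), ← h3]
        refine Finset.sum_congr rfl fun i _ => ?_
        rw [map_pow φ a (p ^ m), pow_mul]
      rw [add_eq_zero_iff_neg_eq.1 h2 |>.symm]
      exact D.neg_mem (D.sum_mem fun i _ => hDpow _)
    have hDclosed : IsClosed (D : Set V) :=
      (C.isClosed_topologicalClosure.isCompact.image T.continuous).isClosed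
    set W := AddSubgroup.zmultiples b ⊔ D with hW
    have hWmem : ∀ v, v ∈ W ↔ ∃ i ∈ Finset.range p, v - i • b ∈ D := by
      intro v
      rw [hW, AddSubgroup.mem_sup]
      constructor
      · rintro ⟨_, ⟨j, rfl⟩, d, hd, rfl⟩
        have hp0 : (0 : ℤ) < p := by exact_mod_cast hp.pos
        refine ⟨(j % p).toNat, ?_, ?_⟩
        · rw [Finset.mem_range]
          have := Int.emod_lt_of_pos j hp0
          have := Int.emod_nonneg j hp0.ne'
          omega
        · have h1 : ((j % p).toNat : ℤ) = j % p := Int.toNat_of_nonneg (Int.emod_nonneg j hp0.ne')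
          have h2 : j • b + d - (j % p).toNat • b = d + (j / p) • (p • b) := by
            rw [← natCast_zsmul b (j % p).toNat, h1, ← natCast_zsmul b p, ← mul_smul]
            have h3 : j • b = (j % p + p * (j / p)) • b := by rw [Int.emod_add_mul_ediv]
            rw [h3, add_smul, mul_comm]; abel
          simp only
          rw [h2]
          exact D.add_mem hd (D.zsmul_mem hpb _)
      · rintro ⟨i, -, h⟩
        exact ⟨i • b, nsmul_mem (AddSubgroup.mem_zmultiples b) i, _, h, by abel⟩
    have hWclosed : IsClosed (W : Set V) := by
      have h1 : (W : Set V) = ⋃ i ∈ Finset.range p, (fun v => v - i • b) ⁻¹' (D : Set V) := by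
        ext v
        simp only [SetLike.mem_coe, hWmem, Set.mem_iUnion, Set.mem_preimage, exists_prop]
      rw [h1]
      exact isClosed_biUnion_finset fun i _ => hDclosed.preimage (by fun_prop)
    have hBW : B ≤ W := by
      refine C.topologicalClosure_minimal ?_ hWclosed
      rw [hC, AddSubgroup.closure_le]
      rintro _ ⟨i, rfl⟩
      rw [SetLike.mem_coe, hW, AddSubgroup.mem_sup]
      exact ⟨b, AddSubgroup.mem_zmultiples b, _, hDpow i, by abel⟩
    have hWB : W = B :=
      le_antisymm (sup_le (by rwa [AddSubgroup.zmultiples_le]) hDB) hBW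
    have hrel : D.relIndex B ∣ p := by
      rw [← hWB, hW, AddSubgroup.relIndex_sup_right]
      have h1 : (AddSubgroup.zmultiples (p • b)).relIndex (AddSubgroup.zmultiples b) = p := by
        have h2 : Function.Injective (zmultiplesHom V b) := by
          rw [injective_iff_map_eq_zero]
          intro j hj
          rw [zmultiplesHom_apply] at hj
          by_contra hj0
          refine hb (htf j.natAbs (Int.natAbs_ne_zero.2 hj0) b ?_)
          rcases Int.natAbs_eq j with h | h
          · rw [← natCast_zsmul, ← h, hj]
          · rw [← neg_eq_zero, ← natCast_zsmul, ← neg_smul, ← h, hj]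
        have h3 := AddSubgroup.relIndex_map_map_of_injective (AddSubgroup.zmultiples (p : ℤ))
          (⊤ : AddSubgroup ℤ) h2
        rw [AddSubgroup.relIndex_top_right, Int.index_zmultiples, Int.natAbs_natCast,
          AddMonoidHom.map_zmultiples, ← AddMonoidHom.range_eq_map] at h3
        refine Eq.trans ?_ h3
        congr 1
        simp
      conv_rhs => rw [← h1]
      exact AddSubgroup.relIndex_dvd_of_le_left _ (by rwa [AddSubgroup.zmultiples_le])
    have h1 := AddSubgroup.relIndex_mul_index hDB
    have hDT : D ≤ T.toAddEnd.range := by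
      rintro _ ⟨v, -, rfl⟩
      exact ⟨v, rfl⟩
    have h2 := AddSubgroup.relIndex_mul_index hDT
    have hTinj' : Function.Injective T.toAddEnd := (injective_iff_map_eq_zero _).2 hTinj
    have h3 : D.relIndex T.toAddEnd.range = B.index := by
      rw [hD, AddMonoidHom.range_eq_map, AddSubgroup.relIndex_map_map_of_injective _ _ hTinj',
        AddSubgroup.relIndex_top_right]
    rw [h3] at h2
    -- Computing |V : TB| through B and through TV, and using |TV : TB| = |V : B| for the injective
    -- T, gives |V : TV| = |B : TB|.
    have h4 : T.toAddEnd.range.index = D.relIndex B := by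
      refine Nat.eq_of_mul_eq_mul_left (Nat.pos_of_ne_zero hBfi.index_ne_zero) ?_
      rw [h2, ← h1, mul_comm]
    rw [h4]
    exact hrel
  have hεinj : Function.Injective (φ e - 1 : V →L[ℤ] V).toAddEnd := by
    refine (injective_iff_map_eq_zero _).2 fun v hv => hTinj v ?_
    rw [hTS']
    change S ((φ e - 1 : V →L[ℤ] V) v) = 0
    have : (φ e - 1 : V →L[ℤ] V) v = 0 := hv
    rw [this, map_zero]
  have hle : T.toAddEnd.range ≤ (φ e - 1 : V →L[ℤ] V).toAddEnd.range := by
    rintro _ ⟨v, rfl⟩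
    exact ⟨S v, by rw [hTS]; rfl⟩
  have h5 := AddSubgroup.relIndex_mul_index hle
  have h6 : T.toAddEnd.range.relIndex (φ e - 1 : V →L[ℤ] V).toAddEnd.range =
      S.toAddEnd.range.index := by
    have h7 : T.toAddEnd.range = S.toAddEnd.range.map (φ e - 1 : V →L[ℤ] V).toAddEnd := by
      ext v
      constructor
      · rintro ⟨v, rfl⟩
        exact ⟨S v, ⟨v, rfl⟩, by rw [hTS]; rfl⟩
      · rintro ⟨_, ⟨v, rfl⟩, rfl⟩
        exact ⟨v, by rw [hTS]; rfl⟩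
    rw [h7, AddMonoidHom.range_eq_map (φ e - 1 : V →L[ℤ] V).toAddEnd,
      AddSubgroup.relIndex_map_map_of_injective _ _ hεinj, AddSubgroup.relIndex_top_right]
  rw [h6] at h5
  -- The indices of SV and (e − 1)V multiply to a divisor of p, so one of the two maps is
  -- surjective.
  have hprime : S.toAddEnd.range.index = 1 ∨ (φ e - 1 : V →L[ℤ] V).toAddEnd.range.index = 1 := by
    rw [← h5] at hidx
    rcases (Nat.dvd_prime hp).1 hidx with h | h
    · exact Or.inl (Nat.eq_one_of_mul_eq_one_right h)
    · rcases (Nat.prime_mul_iff.1 (h ▸ hp)) with h | h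
      · exact Or.inr h.2
      · exact Or.inl h.2
  rcases hprime with h | h
  · refine not_surjective_geom_sum hp (φ e) hεn hfi hV₁ hk (hinv e) ?_
    exact AddMonoidHom.range_eq_top.1 (AddSubgroup.index_eq_one.1 h)
  · refine not_surjective_sub_one hp (φ e) hεn hfi hV₁ hk (hinv e) ?_
    exact AddMonoidHom.range_eq_top.1 (AddSubgroup.index_eq_one.1 h)

end

end LatticeAction

/-! ### Conjugates of subgroups and normalizers. -/

section ConjBy

variable {G : Type*} [Group G]

/-- The conjugate `g L g⁻¹` of a subgroup. -/
def conjBy (g : G) (L : Subgroup G) : Subgroup G := L.comap (MulAut.conj g⁻¹).toMonoidHom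

theorem mem_conjBy {g x : G} {L : Subgroup G} : x ∈ conjBy g L ↔ g⁻¹ * x * g ∈ L := by
  simp [conjBy]

theorem conjBy_conjBy (g h : G) (L : Subgroup G) : conjBy g (conjBy h L) = conjBy (g * h) L := by
  ext x
  rw [mem_conjBy, mem_conjBy, mem_conjBy]
  have e : (g * h)⁻¹ * x * (g * h) = h⁻¹ * (g⁻¹ * x * g) * h := by group
  rw [e]

theorem conjBy_one (L : Subgroup G) : conjBy 1 L = L := by
  ext x; simp [mem_conjBy]

theorem conjBy_mono (g : G) {L M : Subgroup G} (h : L ≤ M) : conjBy g L ≤ conjBy g M :=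
  Subgroup.comap_mono h

theorem conjBy_bot (g : G) : conjBy g (⊥ : Subgroup G) = ⊥ := by
  ext x
  rw [mem_conjBy, mem_bot, mem_bot]
  constructor
  · intro h
    have : x = g * (g⁻¹ * x * g) * g⁻¹ := by group
    rw [this, h]; group
  · rintro rfl; group

theorem conjBy_ne_bot (g : G) {L : Subgroup G} (h : L ≠ ⊥) : conjBy g L ≠ ⊥ := by
  intro e
  apply h
  rw [← conjBy_one L, ← inv_mul_cancel g, ← conjBy_conjBy, e, conjBy_bot]

theorem conjBy_inf (g : G) (L M : Subgroup G) : conjBy g (L ⊓ M) = conjBy g L ⊓ conjBy g M := rfl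

theorem conjBy_sInf (g : G) (S : Set (Subgroup G)) : conjBy g (sInf S) = sInf (conjBy g '' S) := by
  ext x
  simp only [mem_conjBy, Subgroup.mem_sInf, Set.forall_mem_image]

theorem mem_normalizer_of_conj_mem {H L : Subgroup G} (h : ∀ g ∈ H, ∀ l ∈ L, g * l * g⁻¹ ∈ L) :
    H ≤ normalizer (L : Set G) := by
  intro g hg
  rw [mem_normalizer_iff]
  intro l
  refine ⟨h g hg l, fun hl => ?_⟩
  have := h g⁻¹ (inv_mem hg) _ hl
  have e : g⁻¹ * (g * l * g⁻¹) * g⁻¹⁻¹ = l := by group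
  rwa [e] at this

theorem conj_mem_of_le_normalizer {H L : Subgroup G} (h : H ≤ normalizer (L : Set G)) {g l : G}
    (hg : g ∈ H) (hl : l ∈ L) : g * l * g⁻¹ ∈ L :=
  (mem_normalizer_iff.1 (h hg) l).1 hl

theorem le_normalizer_conjBy {H L : Subgroup G} [H.Normal] (h : H ≤ normalizer (L : Set G)) (g : G) :
    H ≤ normalizer (conjBy g L : Set G) := by
  apply mem_normalizer_of_conj_mem
  intro a ha l hl
  rw [mem_conjBy] at hl ⊢
  have := conj_mem_of_le_normalizer h (Normal.conj_mem ‹_› a ha g⁻¹) hl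
  have e : g⁻¹ * (a * l * a⁻¹) * g = g⁻¹ * a * g⁻¹⁻¹ * (g⁻¹ * l * g) * (g⁻¹ * a * g⁻¹⁻¹)⁻¹ := by
    group
  rwa [e]

theorem conjBy_eq_of_mem_normalizer {L : Subgroup G} {g : G} (hg : g ∈ normalizer (L : Set G)) :
    conjBy g L = L := by
  ext x
  rw [mem_conjBy, mem_normalizer_iff.1 hg]
  have e : g * (g⁻¹ * x * g) * g⁻¹ = x := by group
  rw [e]

theorem mem_normalizer_of_conjBy_eq {L : Subgroup G} {g : G} (hg : conjBy g L = L) :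
    g ∈ normalizer (L : Set G) := by
  rw [mem_normalizer_iff]
  intro x
  conv_rhs => rw [← hg, mem_conjBy]
  have e : g⁻¹ * (g * x * g⁻¹) * g = x := by group
  rw [e]

theorem commute_of_disjoint_of_le_normalizer {H K L : Subgroup G} (hK : H ≤ normalizer (K : Set G))
    (hL : H ≤ normalizer (L : Set G)) (hKH : K ≤ H) (hLH : L ≤ H) (hd : K ⊓ L = ⊥) {a b : G}
    (ha : a ∈ K) (hb : b ∈ L) : a * b = b * a := by
  have h1 : a * b * a⁻¹ * b⁻¹ ∈ K ⊓ L := by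
    refine mem_inf.2 ⟨?_, L.mul_mem (conj_mem_of_le_normalizer hL (hKH ha) hb) (L.inv_mem hb)⟩
    have := K.mul_mem ha (conj_mem_of_le_normalizer hK (hLH hb) (K.inv_mem ha))
    simpa only [mul_assoc] using this
  rw [hd, mem_bot] at h1
  exact mul_inv_eq_iff_eq_mul.1 (mul_inv_eq_one.1 h1)

end ConjBy

/-! ### Subgroups normal in an open subgroup: open, or F is virtually abelian. -/

section Profinite

variable {G : Type*} [Group G] [TopologicalSpace G] [IsTopologicalGroup G]

theorem isClosed_conjBy (g : G) {L : Subgroup G} (hL : IsClosed (L : Set G)) :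
    IsClosed (conjBy g L : Set G) := by
  have : Continuous fun x : G => g⁻¹ * x * g := by fun_prop
  convert hL.preimage this using 1
  ext x
  simp [mem_conjBy]

theorem le_normalizer_topologicalClosure {H L : Subgroup G} (h : ∀ g ∈ H, ∀ l ∈ L, g * l * g⁻¹ ∈ L) :
    H ≤ normalizer (L.topologicalClosure : Set G) := by
  apply mem_normalizer_of_conj_mem
  intro g hg
  have h1 : L ≤ L.topologicalClosure.comap (MulAut.conj g).toMonoidHom := by
    intro l hl
    exact L.le_topologicalClosure (h g hg l hl)
  have hc : Continuous fun x : G => g * x * g⁻¹ := by fun_prop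
  exact L.topologicalClosure_minimal h1 (L.isClosed_topologicalClosure.preimage hc)

variable [CompactSpace G]

theorem finiteIndex_of_isOpen {H : Subgroup G} (hH : IsOpen (H : Set G)) : H.FiniteIndex := by
  have := H.quotient_finite_of_isOpen hH
  exact Subgroup.finiteIndex_of_finite_quotient

theorem isOpen_normalCore {H : Subgroup G} (hH : IsOpen (H : Set G)) :
    IsOpen (H.normalCore : Set G) := by
  have := finiteIndex_of_isOpen hH
  apply Subgroup.isOpen_of_isClosed_of_finiteIndex
  rw [normalCore_eq_iInf_comap_conj, coe_iInf]
  refine isClosed_iInter fun g => ?_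
  have hc : Continuous fun x : G => g * x * g⁻¹ := by fun_prop
  exact (H.isClosed_of_isOpen hH).preimage hc

theorem finite_of_isOpen_of_finite {H : Subgroup G} (hH : IsOpen (H : Set G)) (hf : Finite H) :
    Finite G := by
  have := finiteIndex_of_isOpen hH
  have h1 := H.card_mul_index
  refine Nat.finite_of_card_ne_zero ?_
  rw [← h1]
  exact mul_ne_zero Nat.card_pos.ne' this.index_ne_zero

theorem exists_isOpen_normal_notMem [TotallyDisconnectedSpace G] [T2Space G] {b : G} (hb : b ≠ 1) :
    ∃ N : Subgroup G, IsOpen (N : Set G) ∧ N.Normal ∧ b ∉ N := by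
  obtain ⟨N, hN⟩ := ProfiniteGrp.exist_openNormalSubgroup_sub_open_nhds_of_one
    (isOpen_compl_singleton (x := b)) (by simpa using hb.symm)
  exact ⟨N.toSubgroup, N.isOpen', N.isNormal', fun h => hN h rfl⟩

/-- Every element of `D` has `p`-power order modulo every open normal subgroup of `G`. -/
def IsProPIn (p : ℕ) (D : Subgroup G) : Prop :=
  ∀ N : Subgroup G, IsOpen (N : Set G) → N.Normal → ∀ d ∈ D, ∃ k : ℕ, d ^ p ^ k ∈ N

/-- `F` plays the role of the Frattini subgroup of the open pro-`p` subgroup `O`, it is just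
infinite, and it meets every nontrivial closed normal subgroup of `G`. -/
structure IsJustInfiniteFrattini (p : ℕ) (O F : Subgroup G) : Prop where
  isOpen_left : IsOpen (O : Set G)
  isOpen_right : IsOpen (F : Set G)
  le : F ≤ O
  normal : F.Normal
  isProPIn : IsProPIn p O
  nongenerating : ∀ S : Subgroup G, IsOpen (S : Set G) → S ≤ O → O ≤ S ⊔ F → O ≤ S
  isOpen_of_le : ∀ L : Subgroup G, IsClosed (L : Set G) → L ≠ ⊥ → L ≤ F →
    F ≤ normalizer (L : Set G) → IsOpen (L : Set G)
  inf_ne_bot : ∀ K : Subgroup G, IsClosed (K : Set G) → K.Normal → K ≠ ⊥ → K ⊓ F ≠ ⊥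

namespace IsJustInfiniteFrattini

variable [T2Space G] {p : ℕ} {O F : Subgroup G}

/-- A nontrivial closed subgroup normalized by an open normal subgroup `H` containing it is open,
unless `F` is virtually abelian. -/
theorem isOpen_or_exists_abelian (h : IsJustInfiniteFrattini p O F) {H L : Subgroup G}
    (hH : IsOpen (H : Set G)) [H.Normal] (hHF : H ≤ F) (hL : IsClosed (L : Set G)) (hL1 : L ≠ ⊥)
    (hLH : L ≤ H) (hn : H ≤ normalizer (L : Set G)) :
    IsOpen (L : Set G) ∨ ∃ B : Subgroup G, IsOpen (B : Set G) ∧ B.Normal ∧ B ≤ F ∧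
      ∀ a ∈ B, ∀ b ∈ B, a * b = b * a := by
  have hFn := h.normal
  have hHO : H ≤ O := hHF.trans h.le
  set orb : Set (Subgroup G) := (fun g => conjBy g L) '' (O : Set G) with horb
  -- H normalizes L, so a conjugate of L depends only on a coset of the open subgroup H.
  have hfin : orb.Finite := by
    have : Finite (G ⧸ H) := H.quotient_finite_of_isOpen hH
    refine (Set.finite_range fun q : G ⧸ H => conjBy q.out L).subset ?_
    rintro _ ⟨g, -, rfl⟩
    refine ⟨(g : G ⧸ H), ?_⟩
    obtain ⟨k, hk⟩ := QuotientGroup.mk_out_eq_mul H g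
    simp only
    rw [hk, ← conjBy_conjBy, conjBy_eq_of_mem_normalizer (hn k.2)]
  set fam : Set (Subgroup G) := sInf '' {S | S ⊆ orb ∧ S.Nonempty} with hfam
  have hfamfin : fam.Finite := (hfin.finite_subsets.subset fun S hS => hS.1).image _
  have hLfam : L ∈ fam := by
    refine ⟨{L}, ⟨?_, Set.singleton_nonempty _⟩, sInf_singleton⟩
    rw [Set.singleton_subset_iff]
    exact ⟨1, O.one_mem, conjBy_one L⟩
  have hinf : ∀ K ∈ fam, ∀ M ∈ fam, K ⊓ M ∈ fam := by
    rintro _ ⟨S, ⟨hS, hS'⟩, rfl⟩ _ ⟨T, ⟨hT, -⟩, rfl⟩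
    exact ⟨S ∪ T, ⟨Set.union_subset hS hT, hS'.inl⟩, sInf_union⟩
  have hconj : ∀ K ∈ fam, ∀ g ∈ O, conjBy g K ∈ fam := by
    rintro _ ⟨S, ⟨hS, hS'⟩, rfl⟩ g hg
    refine ⟨conjBy g '' S, ⟨?_, hS'.image _⟩, (conjBy_sInf g S).symm⟩
    rintro _ ⟨_, hM, rfl⟩
    obtain ⟨g', hg', rfl⟩ := hS hM
    exact ⟨g * g', O.mul_mem hg hg', (conjBy_conjBy g g' L).symm⟩
  have horbH : ∀ M ∈ orb, M ≤ H ∧ IsClosed (M : Set G) ∧ H ≤ normalizer (M : Set G) := by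
    rintro _ ⟨g, hg, rfl⟩
    refine ⟨fun x hx => ?_, isClosed_conjBy g hL, le_normalizer_conjBy hn g⟩
    have := (inferInstance : H.Normal).conj_mem _ (hLH (mem_conjBy.1 hx)) g
    have e : g * (g⁻¹ * x * g) * g⁻¹ = x := by group
    rwa [e] at this
  have hfamH : ∀ K ∈ fam, K ≤ H ∧ IsClosed (K : Set G) ∧ H ≤ normalizer (K : Set G) := by
    rintro _ ⟨S, ⟨hS, M, hM⟩, rfl⟩
    refine ⟨(sInf_le hM).trans (horbH M (hS hM)).1, ?_, ?_⟩
    · rw [coe_sInf]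
      exact isClosed_biInter fun M hM => (horbH M (hS hM)).2.1
    · apply mem_normalizer_of_conj_mem
      intro g hg l hl
      rw [mem_sInf] at hl ⊢
      exact fun M hM => conj_mem_of_le_normalizer (horbH M (hS hM)).2.2 hg (hl M hM)
  obtain ⟨K, hKL, ⟨hK, hK1⟩, hmin⟩ := (hfamfin.subset (fun _ hx => hx.1) :
    {K | K ∈ fam ∧ K ≠ ⊥}.Finite).exists_le_minimal ⟨hLfam, hL1⟩
  obtain ⟨hKH, hKc, hKn⟩ := hfamH K hK
  set S := O ⊓ normalizer (K : Set G) with hS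
  have hHS : H ≤ S := le_inf hHO hKn
  by_cases hOS : O ≤ S ⊔ F
  · left
    have h1 := h.nongenerating S (isOpen_mono hHS hH) inf_le_left hOS
    exact isOpen_mono hKL (h.isOpen_of_le K hKc hK1 (hKH.trans hHF)
      (h.le.trans (h1.trans inf_le_right)))
  · right
    obtain ⟨g, hgO, hg⟩ := SetLike.not_le_iff_exists.1 hOS
    -- distinct conjugates commute
    have hstab : ∀ u ∈ O, K ⊓ conjBy u K ≠ ⊥ → u ∈ S := by
      intro u hu hne
      have h1 : K ≤ conjBy u K :=
        (hmin ⟨hinf K hK _ (hconj K hK u hu), hne⟩ inf_le_left).trans inf_le_right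
      have h2 : conjBy u⁻¹ K ≤ K := by
        have := conjBy_mono u⁻¹ h1
        rwa [conjBy_conjBy, inv_mul_cancel, conjBy_one] at this
      have h3 : conjBy u⁻¹ K = K := le_antisymm h2
        (hmin ⟨hconj K hK _ (O.inv_mem hu), conjBy_ne_bot _ hK1⟩ h2)
      exact mem_inf.2 ⟨hu, inv_inv u ▸ Subgroup.inv_mem _ (mem_normalizer_of_conjBy_eq h3)⟩
    have hdisj : ∀ f ∈ F, ∀ f' ∈ F, conjBy f K ⊓ conjBy (g * f') K = ⊥ := by
      intro f hf f' hf'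
      by_contra hne
      have h1 := conjBy_ne_bot f⁻¹ hne
      rw [conjBy_inf, conjBy_conjBy, inv_mul_cancel, conjBy_one, conjBy_conjBy] at h1
      have hfO := h.le hf
      have h2 := hstab _ (O.mul_mem (O.inv_mem hfO) (O.mul_mem hgO (h.le hf'))) h1
      apply hg
      have e : g = f * (f⁻¹ * (g * f')) * f'⁻¹ := by group
      rw [e]
      exact mul_mem (mul_mem (mem_sup_right hf) (mem_sup_left h2)) (mem_sup_right (inv_mem hf'))
    -- Members of the two families meet trivially and are normal in H, so they commute. X and Y are
    -- normalized by F, hence have open closures, whose intersection is abelian.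
    set X := ⨆ f : F, conjBy (f : G) K with hX
    set Y := ⨆ f : F, conjBy (g * f) K with hY
    have hXY : X ≤ centralizer (Y : Set G) := by
      refine iSup_le fun f => le_centralizer_iff.1 (iSup_le fun f' => ?_)
      intro b hb
      rw [mem_centralizer_iff]
      intro a ha
      exact commute_of_disjoint_of_le_normalizer
        (hfamH _ (hconj K hK f (h.le f.2))).2.2
        (hfamH _ (hconj K hK _ (O.mul_mem hgO (h.le f'.2)))).2.2
        (hfamH _ (hconj K hK f (h.le f.2))).1
        (hfamH _ (hconj K hK _ (O.mul_mem hgO (h.le f'.2)))).1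
        (hdisj f f.2 f' f'.2) ha hb
    have hcl : ∀ Z : Subgroup G, IsClosed (centralizer (Z : Set G) : Set G) :=
      fun Z => Set.isClosed_centralizer _
    have hXY' : X.topologicalClosure ≤ centralizer (Y.topologicalClosure : Set G) := by
      refine X.topologicalClosure_minimal (le_centralizer_iff.1 ?_) (hcl _)
      exact Y.topologicalClosure_minimal (le_centralizer_iff.1 hXY) (hcl _)
    have hXle : X ≤ F := iSup_le fun f => (hfamH _ (hconj K hK f (h.le f.2))).1.trans hHF
    have hYle : Y ≤ F :=
      iSup_le fun f => (hfamH _ (hconj K hK _ (O.mul_mem hgO (h.le f.2)))).1.trans hHF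
    have hFcl : IsClosed (F : Set G) := F.isClosed_of_isOpen h.isOpen_right
    have hXn : ∀ a ∈ F, ∀ l ∈ X, a * l * a⁻¹ ∈ X := by
      intro a ha
      have : X ≤ X.comap (MulAut.conj a).toMonoidHom := by
        refine iSup_le fun f x hx => ?_
        refine mem_iSup_of_mem (⟨a * f, F.mul_mem ha f.2⟩ : F) ?_
        rw [mem_conjBy] at hx ⊢
        convert hx using 1
        simp only [MulEquiv.toMonoidHom_eq_coe, MonoidHom.coe_coe, MulAut.conj_apply]
        group
      exact this
    have hYn : ∀ a ∈ F, ∀ l ∈ Y, a * l * a⁻¹ ∈ Y := by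
      intro a ha
      have : Y ≤ Y.comap (MulAut.conj a).toMonoidHom := by
        refine iSup_le fun f x hx => ?_
        refine mem_iSup_of_mem (⟨g⁻¹ * a * g * f, F.mul_mem (by
          simpa using hFn.conj_mem a ha g⁻¹) f.2⟩ : F) ?_
        rw [mem_conjBy] at hx ⊢
        convert hx using 1
        simp only [MulEquiv.toMonoidHom_eq_coe, MonoidHom.coe_coe, MulAut.conj_apply]
        group
      exact this
    have hXo : IsOpen (X.topologicalClosure : Set G) := by
      refine h.isOpen_of_le _ X.isClosed_topologicalClosure ?_
        (X.topologicalClosure_minimal hXle hFcl) (le_normalizer_topologicalClosure hXn)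
      intro e
      refine conjBy_ne_bot 1 hK1 (le_bot_iff.1 ?_)
      rw [← e]
      exact (le_iSup (fun f : F => conjBy (f : G) K) 1).trans X.le_topologicalClosure
    have hYo : IsOpen (Y.topologicalClosure : Set G) := by
      refine h.isOpen_of_le _ Y.isClosed_topologicalClosure ?_
        (Y.topologicalClosure_minimal hYle hFcl) (le_normalizer_topologicalClosure hYn)
      intro e
      refine conjBy_ne_bot (g * (1 : F)) hK1 (le_bot_iff.1 ?_)
      rw [← e]
      exact (le_iSup (fun f : F => conjBy (g * f) K) 1).trans Y.le_topologicalClosure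
    refine ⟨(X.topologicalClosure ⊓ Y.topologicalClosure).normalCore,
      isOpen_normalCore (hXo.inter hYo), inferInstance,
      (normalCore_le _).trans (inf_le_left.trans (X.topologicalClosure_minimal hXle hFcl)), ?_⟩
    intro a ha b hb
    exact (mem_centralizer_iff.1 (hXY' (normalCore_le _ ha).1) b (normalCore_le _ hb).2).symm

/-- A nontrivial closed subgroup invariant under `F` is infinite. -/
theorem infinite_of_le (h : IsJustInfiniteFrattini p O F) [Infinite G] {L : Subgroup G}
    (hL1 : L ≠ ⊥) (hLF : L ≤ F) (hn : F ≤ normalizer (L : Set G)) : Infinite L := by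
  by_contra hfin
  rw [not_infinite_iff_finite] at hfin
  have := finite_of_isOpen_of_finite
    (h.isOpen_of_le L (Set.toFinite (L : Set G)).isClosed hL1 hLF hn) hfin
  exact not_finite G

/-- B centralizes b and has finite index, so b has finitely many conjugates; if b is torsion they
generate a finite subgroup normalized by F, which must be trivial. -/
theorem eq_one_of_pow_eq_one (h : IsJustInfiniteFrattini p O F) [Infinite G] {B : Subgroup G}
    (hB : IsOpen (B : Set G)) [B.Normal] (hBF : B ≤ F) (hBc : ∀ a ∈ B, ∀ b ∈ B, a * b = b * a)
    {n : ℕ} (hn : n ≠ 0) {b : G} (hb : b ∈ B) (hbn : b ^ n = 1) : b = 1 := by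
  by_contra hb1
  have hFn := h.normal
  set s : Set G := (fun f => f * b * f⁻¹) '' (F : Set G) with hs
  have hsB : s ⊆ B := by
    rintro _ ⟨f, -, rfl⟩
    exact (inferInstance : B.Normal).conj_mem b hb f
  have hsfin : s.Finite := by
    have : Finite (G ⧸ B) := B.quotient_finite_of_isOpen hB
    refine (Set.finite_range fun q : G ⧸ B => q.out * b * q.out⁻¹).subset ?_
    rintro _ ⟨g, -, rfl⟩
    refine ⟨(g : G ⧸ B), ?_⟩
    obtain ⟨k, hk⟩ := QuotientGroup.mk_out_eq_mul B g
    have e : g * k * b * (g * k)⁻¹ = g * (k * b) * (k : G)⁻¹ * g⁻¹ := by group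
    simp only
    rw [hk, e, hBc k k.2 b hb]
    group
  have : Finite s := hsfin
  have hclB : Subgroup.closure s ≤ B := (closure_le B).2 hsB
  have hfinc : Finite (Subgroup.closure s) := by
    let _ : CommGroup (Subgroup.closure s) :=
      { (inferInstance : Group (Subgroup.closure s)) with
        mul_comm := fun x y => Subtype.ext (hBc x (hclB x.2) y (hclB y.2)) }
    have hfg : Group.FG (Subgroup.closure s) := Group.closure_finite_fg s
    have hpow : ∀ x ∈ Subgroup.closure s, x ^ n = 1 := by
      intro x hx
      induction hx using Subgroup.closure_induction with
      | mem x hx =>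
        obtain ⟨f, -, rfl⟩ := hx
        simp only [conj_pow, hbn]; group
      | one => exact one_pow n
      | mul x y hx hy hx' hy' =>
        have : Commute x y := hBc x (hclB hx) y (hclB hy)
        rw [this.mul_pow, hx', hy', one_mul]
      | inv x _ hx => rw [inv_pow, hx, inv_one]
    refine @CommGroup.finite_of_fg_isMulTorsion (Subgroup.closure s) _ hfg fun x => ?_
    exact isOfFinOrder_iff_pow_eq_one.2 ⟨n, Nat.pos_of_ne_zero hn, Subtype.ext (hpow x x.2)⟩
  have hbs : b ∈ Subgroup.closure s := Subgroup.subset_closure ⟨1, F.one_mem, by simp⟩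
  have : Infinite (Subgroup.closure s) := by
    refine h.infinite_of_le ?_ (hclB.trans hBF) (mem_normalizer_of_conj_mem ?_)
    · intro e
      rw [e] at hbs
      exact hb1 (mem_bot.1 hbs)
    · intro f hf
      have hle : Subgroup.closure s ≤ (Subgroup.closure s).comap (MulAut.conj f).toMonoidHom := by
        rw [closure_le]
        rintro _ ⟨g, hg, rfl⟩
        refine Subgroup.subset_closure ⟨f * g, F.mul_mem hf hg, ?_⟩
        simp only [MulEquiv.toMonoidHom_eq_coe, MonoidHom.coe_coe, MulAut.conj_apply]
        group
      exact hle
  exact not_finite (Subgroup.closure s)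

end IsJustInfiniteFrattini

end Profinite

/-! ### Conjugation on an abelian normal subgroup as a continuous linear action. -/

section ConjAction

open scoped IsMulCommutative

variable {G : Type*} [Group G] [TopologicalSpace G] [IsTopologicalGroup G]

/-- The conjugation action of `G` on an abelian normal subgroup, written additively. -/
def conjEnd (B : Subgroup G) [B.Normal] [IsMulCommutative B] :
    G →* (Additive B →L[ℤ] Additive B) where
  toFun g :=
    { toLinearMap := ((MulAut.conjNormal (H := B) g).toMonoidHom.toAdditive).toIntLinearMap
      cont := by
        have h1 : Continuous fun b : B => MulAut.conjNormal g b := by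
          refine Continuous.subtype_mk (f := fun b : B => g * b * g⁻¹) ?_ _
          fun_prop
        exact h1 }
  map_one' := by
    ext v
    exact congrArg (fun f : MulAut B => ((f v.toMul : B) : G)) (map_one (MulAut.conjNormal (H := B)))
  map_mul' g h := by
    ext v
    exact congrArg (fun f : MulAut B => ((f v.toMul : B) : G))
      (map_mul (MulAut.conjNormal (H := B)) g h)

theorem coe_conjEnd_apply (B : Subgroup G) [B.Normal] [IsMulCommutative B] (g : G) (v : Additive B) :
    ((conjEnd B g v).toMul : G) = g * v.toMul * g⁻¹ := rfl

theorem conjEnd_eq_one_iff (B : Subgroup G) [B.Normal] [IsMulCommutative B] (g : G) :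
    conjEnd B g = 1 ↔ ∀ b ∈ B, g * b = b * g := by
  constructor
  · intro h b hb
    have h1 := coe_conjEnd_apply B g (Additive.ofMul ⟨b, hb⟩)
    rw [h] at h1
    exact (mul_inv_eq_iff_eq_mul.1 h1.symm)
  · intro h
    ext v
    change g * v.toMul * g⁻¹ = v.toMul
    rw [h _ v.toMul.2, mul_inv_cancel_right]

end ConjAction

/-! ### The virtually abelian case, and passage to arbitrary open normalizers. -/

namespace IsJustInfiniteFrattini

variable {G : Type*} [Group G] [TopologicalSpace G] [IsTopologicalGroup G] [CompactSpace G]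
  [T2Space G] {p : ℕ} {O F : Subgroup G}

-- O acts on the torsion-free group B through a finite p-group P. Nongeneration puts the image Q of
-- F inside Φ(P), just infiniteness makes Q irreducible, and such a Q is trivial.
open scoped IsMulCommutative in
theorem commute_of_abelian [TotallyDisconnectedSpace G] [Fact p.Prime]
    (h : IsJustInfiniteFrattini p O F) [Infinite G] {B : Subgroup G}
    (hB : IsOpen (B : Set G)) [hBn : B.Normal] (hBF : B ≤ F) (hBc : ∀ a ∈ B, ∀ b ∈ B, a * b = b * a) :
    ∀ f ∈ F, ∀ b ∈ B, f * b = b * f := by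
  have hp : p.Prime := Fact.out
  have hFn := h.normal
  have : IsMulCommutative B := ⟨⟨fun a b => Subtype.ext (hBc a a.2 b b.2)⟩⟩
  have hBcl : IsClosed (B : Set G) := B.isClosed_of_isOpen hB
  have : CompactSpace B := isCompact_iff_compactSpace.1 hBcl.isCompact
  have : CompactSpace (Additive B) := ‹CompactSpace B›
  have : T2Space (Additive B) := (inferInstance : T2Space B)
  have hBO : B ≤ O := hBF.trans h.le
  -- the finite `p`-group induced by `O` on `B`
  set r : O →* (Additive B →L[ℤ] Additive B)ˣ := ((conjEnd B).comp O.subtype).toHomUnits with hr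
  have hr1 : ∀ o : O, r o = 1 ↔ ∀ b ∈ B, (o : G) * b = b * o := by
    intro o
    rw [← conjEnd_eq_one_iff, Units.ext_iff]
    rfl
  have hkerB : B.subgroupOf O ≤ r.ker := by
    intro o ho
    exact (hr1 o).2 fun b hb => hBc _ ho _ hb
  set P := r.range with hP
  set φ : P →* (Additive B →L[ℤ] Additive B) := (Units.coeHom _).comp P.subtype with hφ
  have hφi : Function.Injective φ := fun x y e => Subtype.ext (Units.ext e)
  set q : O →* P := r.rangeRestrict with hq
  have hqs : Function.Surjective q := r.rangeRestrict_surjective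
  have hqr : ∀ o : O, q o = 1 ↔ ∀ b ∈ B, (o : G) * b = b * o := by
    intro o
    rw [← hr1, Subtype.ext_iff]
    rfl
  have hφq : ∀ (o : O) (v : Additive B), ((φ (q o) v).toMul : G) = o * v.toMul * (o : G)⁻¹ := by
    intro o v; rfl
  have hPfin : Finite P := by
    have : (B.subgroupOf O).FiniteIndex := by
      have := finiteIndex_of_isOpen hB
      infer_instance
    have : r.ker.FiniteIndex := finiteIndex_of_le hkerB
    exact Finite.of_equiv _ (QuotientGroup.quotientKerEquivRange r).toEquiv
  have hPp : IsPGroup p P := by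
    intro g
    obtain ⟨o, rfl⟩ := hqs g
    obtain ⟨k, hk⟩ := h.isProPIn B hB hBn o o.2
    refine ⟨k, ?_⟩
    rw [← map_pow, hqr]
    exact fun b hb => hBc _ hk b hb
  set Q := (F.subgroupOf O).map q with hQ
  have hQn : Q.Normal := Subgroup.Normal.map inferInstance q hqs
  -- A maximal subgroup of P missing part of Q would pull back to a proper open subgroup S of O with
  -- O = SF.
  have hQf : Q ≤ frattini P := by
    rw [frattini, Order.radical, le_iInf_iff]
    intro M
    refine le_iInf fun hM => ?_
    by_contra hQM
    have htop : M ⊔ Q = ⊤ := hM.2 _ (lt_of_le_of_ne le_sup_left fun e => hQM (e ▸ le_sup_right))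
    set S := (M.comap q).map O.subtype with hS
    have hmemS : ∀ o : O, (o : G) ∈ S ↔ q o ∈ M := by
      intro o
      rw [hS]
      constructor
      · rintro ⟨o', ho', e⟩
        rwa [← Subtype.ext e]
      · intro ho; exact ⟨o, ho, rfl⟩
    have hSO : O ≤ S := by
      refine h.nongenerating S ?_ (by rintro _ ⟨o, -, rfl⟩; exact o.2) ?_
      · refine isOpen_mono (fun b hb => ?_) hB
        rw [← show (((⟨b, hBO hb⟩ : O) : G)) = b from rfl, hmemS, (hqr _).2 fun b' hb' => hBc b hb b' hb']
        exact M.one_mem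
      · intro o ho
        have h1 : q ⟨o, ho⟩ ∈ M ⊔ Q := htop ▸ mem_top _
        obtain ⟨m, hm, _, ⟨f, hf, rfl⟩, e⟩ := mem_sup_of_normal_right.1 h1
        have h2 : ((⟨o, ho⟩ * f⁻¹ : O) : G) ∈ S := by
          have h4 : q (⟨o, ho⟩ * f⁻¹) = m := by
            rw [MonoidHom.map_mul, ← e, mul_assoc, ← MonoidHom.map_mul, mul_inv_cancel f,
              MonoidHom.map_one, mul_one]
          rw [hmemS, h4]
          exact hm
        have h3 : o = ((⟨o, ho⟩ * f⁻¹ : O) : G) * f := by simp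
        rw [h3]
        exact mul_mem (mem_sup_left h2) (mem_sup_right hf)
    refine hM.1 ((eq_top_iff' _).2 fun g => ?_)
    obtain ⟨o, rfl⟩ := hqs g
    exact (hmemS o).1 (hSO o.2)
  have hirr : IsTopologicallyIrreducible (φ '' Q) := by
    intro W hW hW1 hinv
    set L : Subgroup G := (AddSubgroup.toSubgroup W : Subgroup B).map B.subtype with hL
    have hmemL : ∀ b : B, (b : G) ∈ L ↔ Additive.ofMul b ∈ W := by
      intro b
      rw [hL]
      constructor
      · rintro ⟨b', hb', e⟩
        rwa [← Subtype.ext e]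
      · intro hb; exact ⟨b, hb, rfl⟩
    have hLB : L ≤ B := by rintro _ ⟨b, -, rfl⟩; exact b.2
    have hLo : IsOpen (L : Set G) := by
      refine h.isOpen_of_le L ?_ ?_ (hLB.trans hBF) (mem_normalizer_of_conj_mem ?_)
      · exact hBcl.isClosedEmbedding_subtypeVal.isClosedMap _ hW
      · intro e
        apply hW1
        rw [AddSubgroup.eq_bot_iff_forall]
        intro v hv
        have h1 : (v.toMul : G) ∈ L := (hmemL v.toMul).2 hv
        rw [e, mem_bot] at h1
        exact Additive.toMul.injective (Subtype.ext h1)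
      · intro f hf l hl
        have hlB := hLB hl
        have h1 := hinv (φ (q ⟨f, h.le hf⟩)) ⟨_, ⟨_, hf, rfl⟩, rfl⟩
          (Additive.ofMul ⟨l, hlB⟩) ((hmemL ⟨l, hlB⟩).1 hl)
        exact (hmemL _).2 h1
    have hLfi := finiteIndex_of_isOpen hLo
    have h1 : (L.subgroupOf B).FiniteIndex := inferInstance
    have h2 : L.subgroupOf B = AddSubgroup.toSubgroup W := by
      ext b; exact hmemL b
    rw [h2] at h1
    refine ⟨?_⟩
    have h3 := h1.index_ne_zero
    exact h3
  have htf : ∀ n : ℕ, n ≠ 0 → ∀ v : Additive B, n • v = 0 → v = 0 := by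
    intro n hn v hv
    have h1 : ((v.toMul : B) : G) ^ n = 1 := by
      have := congrArg (fun v : Additive B => (v.toMul : G)) hv
      simpa using this
    exact Additive.toMul.injective
      (Subtype.ext (h.eq_one_of_pow_eq_one hB hBF hBc hn v.toMul.2 h1))
  obtain ⟨b, hb, hb1⟩ : ∃ b ∈ B, b ≠ 1 := by
    by_contra hcon
    push Not at hcon
    have : Finite B := by
      have : Subsingleton B := ⟨fun a b => Subtype.ext ((hcon a a.2).trans (hcon b b.2).symm)⟩
      infer_instance
    have := finite_of_isOpen_of_finite hB this
    exact not_finite G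
  -- An open normal subgroup avoiding b cuts out a proper invariant V₁ of p-power index in B.
  obtain ⟨N, hN, hNn, hbN⟩ := exists_isOpen_normal_notMem hb1
  set V₁ : AddSubgroup (Additive B) := Subgroup.toAddSubgroup (N.subgroupOf B) with hV₁
  have hNfi := finiteIndex_of_isOpen hN
  have hNBfi : (N.subgroupOf B).FiniteIndex := inferInstance
  have hNp : IsPGroup p (B ⧸ N.subgroupOf B) := by
    intro g
    obtain ⟨g, rfl⟩ := QuotientGroup.mk_surjective g
    obtain ⟨k, hk⟩ := h.isProPIn N hN hNn g (hBO g.2)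
    refine ⟨k, ?_⟩
    rw [← QuotientGroup.mk_pow, QuotientGroup.eq_one_iff]
    exact hk
  obtain ⟨k, hk⟩ := IsPGroup.iff_card.1 hNp
  have hQbot : Q = ⊥ := by
    refine hirr.eq_bot_of_le_frattini hPp hφi htf hQf (V₁ := V₁) (k := k) ⟨hNBfi.index_ne_zero⟩ ?_ ?_ ?_
    · intro e
      have : Additive.ofMul (⟨b, hb⟩ : B) ∈ V₁ := e ▸ AddSubgroup.mem_top _
      exact hbN this
    · intro v
      have := (N.subgroupOf B).pow_index_mem v.toMul
      rw [Subgroup.index, hk] at this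
      exact this
    · intro g v hv
      obtain ⟨o, rfl⟩ := hqs g
      have h1 : ((φ (q o) v).toMul : G) ∈ N := by
        rw [hφq]
        exact hNn.conj_mem _ hv _
      exact h1
  intro f hf
  refine (hqr ⟨f, h.le hf⟩).1 ?_
  have : q ⟨f, h.le hf⟩ ∈ Q := ⟨_, hf, rfl⟩
  rw [hQbot] at this
  exact mem_bot.1 this

/-- Schur's theorem: commutators depend only on cosets of the centre, so there are finitely many. -/
theorem _root_.finite_commutator_of_finiteIndex_center {C : Type*} [Group C]
    (hC : (center C).FiniteIndex) : Finite (commutator C) := by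
  have hfin : Finite (C ⧸ center C) := inferInstance
  have : Finite (commutatorSet C) := by
    refine Set.Finite.to_subtype ((Set.finite_range fun q : (C ⧸ center C) × (C ⧸ center C) =>
      q.1.out * q.2.out * q.1.out⁻¹ * q.2.out⁻¹).subset ?_)
    rintro _ ⟨a, b, rfl⟩
    refine ⟨(a, b), ?_⟩
    obtain ⟨x, hx⟩ := QuotientGroup.mk_out_eq_mul (center C) a
    obtain ⟨y, hy⟩ := QuotientGroup.mk_out_eq_mul (center C) b
    have hx' := mem_center_iff.1 x.2
    have hy' := mem_center_iff.1 y.2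
    simp only [commutatorElement_def]
    rw [hx, hy]
    have e1 : a * x * (b * y) * (a * x)⁻¹ * (b * y)⁻¹ =
        a * (x * (b * y)) * (x : C)⁻¹ * a⁻¹ * (b * y)⁻¹ := by group
    have e2 : a * (b * y * x) * (x : C)⁻¹ * a⁻¹ * (b * y)⁻¹ = a * b * (y * a⁻¹) * (y : C)⁻¹ * b⁻¹ := by
      group
    rw [e1, ← hx', e2, ← hy']
    group
  infer_instance

/-- Under `IsJustInfiniteFrattini`, every nontrivial closed subgroup normalized by an open subgroup
is open. -/
theorem isOpen_of_isOpen_le_normalizer [TotallyDisconnectedSpace G] [Fact p.Prime]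
    (h : IsJustInfiniteFrattini p O F) [Infinite G] {H L : Subgroup G}
    (hH : IsOpen (H : Set G)) (hL : IsClosed (L : Set G)) (hL1 : L ≠ ⊥)
    (hn : H ≤ normalizer (L : Set G)) : IsOpen (L : Set G) := by
  have hFn := h.normal
  have hFo := h.isOpen_right
  set H' := (H ⊓ F).normalCore with hH'
  have hH'o : IsOpen (H' : Set G) := isOpen_normalCore (hH.inter hFo)
  have hH'F : H' ≤ F := (normalCore_le _).trans inf_le_right
  have hH'n : H' ≤ normalizer (L : Set G) := ((normalCore_le _).trans inf_le_left).trans hn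
  have hcc : ∀ Z : Subgroup G, IsClosed (centralizer (Z : Set G) : Set G) :=
    fun Z => Set.isClosed_centralizer _
  have hcomm : ∀ Z : Subgroup G, Z.Normal → Z ≤ normalizer (L : Set G) → L ⊓ Z = ⊥ →
      L ≤ centralizer (Z : Set G) := by
    intro Z hZ hZn hd l hl
    rw [mem_centralizer_iff]
    intro z hz
    have h1 : z * l * z⁻¹ * l⁻¹ ∈ L ⊓ Z := by
      refine mem_inf.2 ⟨L.mul_mem (conj_mem_of_le_normalizer hZn hz hl) (L.inv_mem hl), ?_⟩
      have := Z.mul_mem hz (hZ.conj_mem _ (Z.inv_mem hz) l)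
      simpa only [mul_assoc] using this
    rw [hd, mem_bot] at h1
    exact mul_inv_eq_iff_eq_mul.1 (mul_inv_eq_one.1 h1)
  by_cases hva : ∃ B : Subgroup G, IsOpen (B : Set G) ∧ B.Normal ∧ B ≤ F ∧
      ∀ a ∈ B, ∀ b ∈ B, a * b = b * a
  · obtain ⟨B, hB, hBn, hBF, hBc⟩ := hva
    have hFB := h.commute_of_abelian hB hBF hBc
    by_cases hLB : L ⊓ B = ⊥
    · exfalso
      have hZn : (H' ⊓ B).Normal := inferInstance
      have hZo : IsOpen ((H' ⊓ B : Subgroup G) : Set G) := hH'o.inter hB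
      -- C contains L and has centre of finite index, so [C, C] is finite. A nontrivial finite
      -- normal subgroup would have infinite intersection with F, so C is abelian.
      set C := centralizer ((H' ⊓ B : Subgroup G) : Set G) with hC
      have hCn : C.Normal := normal_centralizer
      have hLC : L ≤ C := hcomm _ hZn (inf_le_left.trans hH'n)
        (le_bot_iff.1 (hLB ▸ inf_le_inf_left L inf_le_right))
      have hZfi := finiteIndex_of_isOpen hZo
      have hcenter : (center C).FiniteIndex := by
        refine finiteIndex_of_le (H := (H' ⊓ B).subgroupOf C) ?_
        intro z hz
        rw [mem_center_iff]
        intro c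
        exact Subtype.ext (mem_centralizer_iff.1 c.2 z hz).symm
      have hfin := finite_commutator_of_finiteIndex_center hcenter
      have hD : ⁅C, C⁆ = ⊥ := by
        by_contra hD
        have hDfin : Finite (⁅C, C⁆ : Subgroup G) := by
          rw [← map_subtype_commutator]
          exact Set.Finite.to_subtype ((Set.toFinite (commutator C : Set C)).image C.subtype)
        have hDF := h.inf_ne_bot ⁅C, C⁆ (Set.toFinite ((⁅C, C⁆ : Subgroup G) : Set G)).isClosed
          inferInstance hD
        have : Infinite (⁅C, C⁆ ⊓ F : Subgroup G) := h.infinite_of_le hDF inf_le_right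
          (mem_normalizer_of_conj_mem fun f _ l hl => Normal.conj_mem inferInstance l hl f)
        have : Finite (⁅C, C⁆ ⊓ F : Subgroup G) :=
          Set.Finite.to_subtype (Set.Finite.subset (Set.toFinite ((⁅C, C⁆ : Subgroup G) : Set G))
            (fun x hx => (mem_inf.1 hx).1))
        exact not_finite (⁅C, C⁆ ⊓ F : Subgroup G)
      have hCc : ∀ a ∈ C, ∀ b ∈ C, a * b = b * a := by
        intro a ha b hb
        have h1 := commutator_mem_commutator ha hb
        rw [hD, mem_bot, commutatorElement_def] at h1
        exact mul_inv_eq_iff_eq_mul.1 (mul_inv_eq_one.1 h1)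
      obtain ⟨l, hl, hl1⟩ := (L.bot_or_exists_ne_one).resolve_left hL1
      have hBfi := finiteIndex_of_isOpen hB
      set n := B.index with hn'
      have hln : (l : G) ^ n = 1 := by
        have : (l : G) ^ n ∈ L ⊓ B := mem_inf.2 ⟨L.pow_mem hl n, B.pow_index_mem _⟩
        rwa [hLB, mem_bot] at this
      -- L embeds in the finite group G/B, so the n-torsion X of C is a nontrivial closed normal
      -- subgroup. Then X ∩ F is open but meets the torsion-free B trivially, which would make G
      -- finite.
      let X : Subgroup G :=
        { carrier := {c | c ∈ C ∧ c ^ n = 1}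
          one_mem' := ⟨C.one_mem, one_pow n⟩
          mul_mem' := by
            rintro a b ⟨ha, ha'⟩ ⟨hb, hb'⟩
            refine ⟨C.mul_mem ha hb, ?_⟩
            rw [(show Commute a b from hCc a ha b hb).mul_pow, ha', hb', one_mul]
          inv_mem' := by
            rintro a ⟨ha, ha'⟩
            exact ⟨C.inv_mem ha, by rw [inv_pow, ha', inv_one]⟩ }
      have hXn : X.Normal := by
        refine ⟨fun x hx g => ⟨hCn.conj_mem x hx.1 g, ?_⟩⟩
        rw [conj_pow, hx.2]; group
      have hXcl : IsClosed (X : Set G) :=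
        (hcc _).inter (isClosed_singleton.preimage (continuous_pow n))
      have hX1 : X ≠ ⊥ := by
        intro e
        have : (l : G) ∈ X := ⟨hLC hl, hln⟩
        rw [e, mem_bot] at this
        exact hl1 this
      have hXF := h.inf_ne_bot X hXcl hXn hX1
      have hXFo := h.isOpen_of_le (X ⊓ F) (hXcl.inter (F.isClosed_of_isOpen hFo)) hXF inf_le_right
        (mem_normalizer_of_conj_mem fun f _ l hl => Normal.conj_mem inferInstance l hl f)
      have hbot : X ⊓ F ⊓ B = ⊥ := by
        rw [eq_bot_iff_forall]
        rintro b ⟨hb, hbB⟩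
        exact h.eq_one_of_pow_eq_one hB hBF hBc hBfi.index_ne_zero hbB (mem_inf.1 hb).1.2
      have := finite_of_isOpen_of_finite (H := X ⊓ F ⊓ B) (hXFo.inter hB) (by
        rw [hbot]; infer_instance)
      exact not_finite G
    · refine isOpen_mono inf_le_left (h.isOpen_of_le (L ⊓ B) (hL.inter (B.isClosed_of_isOpen hB)) hLB
        (inf_le_right.trans hBF) (mem_normalizer_of_conj_mem fun f hf l hl => ?_))
      rw [hFB f hf l (mem_inf.1 hl).2, mul_inv_cancel_right]
      exact hl
  -- Otherwise the centralizer C of H' contains L and is nontrivial, so C ∩ F is open and C ∩ F ∩ H'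
  -- is an open abelian normal subgroup.
  · have hLH : L ⊓ H' ≠ ⊥ := by
      intro hd
      apply hva
      set C := centralizer (H' : Set G) with hC
      have hCn : C.Normal := normal_centralizer
      have hLC : L ≤ C := hcomm _ inferInstance hH'n hd
      have hC1 : C ≠ ⊥ := fun e => hL1 (le_bot_iff.1 (e ▸ hLC))
      have hCFo := h.isOpen_of_le (C ⊓ F) ((hcc _).inter (F.isClosed_of_isOpen hFo))
        (h.inf_ne_bot C (hcc _) hCn hC1) inf_le_right
        (mem_normalizer_of_conj_mem fun f _ l hl => Normal.conj_mem inferInstance l hl f)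
      refine ⟨C ⊓ F ⊓ H', hCFo.inter hH'o, inferInstance, inf_le_right.trans hH'F, ?_⟩
      rintro a ⟨-, ha⟩ b ⟨hb, -⟩
      exact mem_centralizer_iff.1 (mem_inf.1 hb).1 a ha
    have h1 := (h.isOpen_or_exists_abelian hH'o hH'F (hL.inter (H'.isClosed_of_isOpen hH'o)) hLH
      inf_le_right (mem_normalizer_of_conj_mem fun f hf l hl => mem_inf.2
        ⟨conj_mem_of_le_normalizer hH'n hf (mem_inf.1 hl).1,
          Normal.conj_mem inferInstance l (mem_inf.1 hl).2 f⟩)).resolve_right hva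
    exact isOpen_mono inf_le_left h1

end IsJustInfiniteFrattini

/-! ### Behaviour of O_p, Φ(O_p) and M_H(A) in finite groups. -/

section FrattiniPCore

variable {p : ℕ} {X Y : Type*} [Group X] [Group Y]

theorem le_pCore {N : Subgroup X} (hN : N.Normal) (hp : IsPGroup p N) : N ≤ pCore p X :=
  le_sSup ⟨hN, hp⟩

theorem pCore_mem [Finite X] : (pCore p X).Normal ∧ IsPGroup p (pCore p X) := by
  obtain ⟨N, -, ⟨hN, hNp⟩, hmax⟩ := (Set.toFinite {N : Subgroup X | N.Normal ∧ IsPGroup p N}).exists_le_maximal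
    (a := ⊥) ⟨inferInstance, IsPGroup.of_bot⟩
  have h : pCore p X = N := by
    refine le_antisymm (sSup_le ?_) (le_pCore hN hNp)
    rintro M ⟨hM, hMp⟩
    have := hmax (y := N ⊔ M) ⟨inferInstance, hNp.to_sup_of_normal_right hMp⟩ le_sup_left
    exact le_sup_right.trans this
  rw [h]
  exact ⟨hN, hNp⟩

instance pCore_normal [Finite X] : (pCore p X).Normal := pCore_mem.1

theorem isPGroup_pCore [Finite X] : IsPGroup p (pCore p X) := pCore_mem.2

theorem pCore_eq_comap [Finite X] [Finite Y] {f : X →* Y} (hf : Function.Surjective f)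
    (hk : IsPGroup p f.ker) : pCore p X = (pCore p Y).comap f := by
  apply le_antisymm
  · rw [← map_le_iff_le_comap]
    exact le_pCore (pCore_normal.map f hf) (isPGroup_pCore.map f)
  · exact le_pCore inferInstance (isPGroup_pCore.comap_of_ker_isPGroup f hk)

theorem frattiniPCore_le : frattiniPCore p X ≤ pCore p X := by
  rintro _ ⟨x, -, rfl⟩
  exact x.2

instance frattiniPCore_normal [Finite X] : (frattiniPCore p X).Normal :=
  ConjAct.normal_of_characteristic_of_normal

theorem frattiniPCore_nongenerating [Finite X] {M : Subgroup X} (hM : M ≤ pCore p X)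
    (h : pCore p X ≤ M ⊔ frattiniPCore p X) : pCore p X ≤ M := by
  rw [← subgroupOf_eq_top]
  apply frattini_nongenerating
  rw [eq_top_iff]
  intro x _
  obtain ⟨m, hm, _, ⟨y, hy, rfl⟩, e⟩ := mem_sup_of_normal_right.1 (h x.2)
  have : x = ⟨m, hM hm⟩ * y := Subtype.ext e.symm
  rw [this]
  exact mul_mem (mem_sup_left (mem_subgroupOf.2 hm)) (mem_sup_right hy)

theorem le_frattiniPCore_of_nongenerating {N : Subgroup X} (hN : N ≤ pCore p X)
    (h : ∀ M ≤ pCore p X, pCore p X ≤ M ⊔ N → pCore p X ≤ M) : N ≤ frattiniPCore p X := by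
  intro x hx
  refine ⟨⟨x, hN hx⟩, ?_, rfl⟩
  rw [frattini, Order.radical]
  simp only [SetLike.mem_coe, Subgroup.mem_iInf]
  intro M hM
  by_contra hxM
  have h1 : M ⊔ N.subgroupOf (pCore p X) = ⊤ :=
    hM.2 _ (lt_of_le_of_ne le_sup_left fun e => hxM (e ▸ mem_sup_right (mem_subgroupOf.2 hx)))
  refine hM.1 ((eq_top_iff' _).2 fun y => ?_)
  have h2 : pCore p X ≤ M.map (pCore p X).subtype := by
    refine h _ (by rintro _ ⟨y, -, rfl⟩; exact y.2) ?_
    have h3 := congrArg (Subgroup.map (pCore p X).subtype) h1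
    rw [Subgroup.map_sup, ← MonoidHom.range_eq_map, range_subtype] at h3
    refine h3.ge.trans (sup_le_sup_left ?_ _)
    rintro _ ⟨y, hy, rfl⟩
    exact hy
  obtain ⟨y', hy', e⟩ := h2 y.2
  rwa [← Subtype.ext e]

/-- Both sides are the largest normal subgroups of nongenerators, and nongeneration transfers in
both directions along f because the kernel itself is nongenerating. -/
theorem frattiniPCore_eq_comap [Finite X] [Finite Y] {f : X →* Y} (hf : Function.Surjective f)
    (hc : pCore p X = (pCore p Y).comap f) (hk : f.ker ≤ frattiniPCore p X) :
    frattiniPCore p X = (frattiniPCore p Y).comap f := by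
  apply le_antisymm
  · rw [← map_le_iff_le_comap]
    refine le_frattiniPCore_of_nongenerating ?_ fun M hM h => ?_
    · rw [map_le_iff_le_comap, ← hc]
      exact frattiniPCore_le
    · have h1 : pCore p X ≤ M.comap f := by
        refine frattiniPCore_nongenerating (hc ▸ comap_mono hM) fun x hx => ?_
        have := (frattiniPCore_normal (p := p) (X := X)).map f hf
        rw [hc] at hx
        obtain ⟨m, hm, _, ⟨u, hu, rfl⟩, e⟩ := mem_sup_of_normal_right.1 (h hx)
        have h2 : x = x * u⁻¹ * u := by group
        rw [h2]
        refine mul_mem (mem_sup_left ?_) (mem_sup_right hu)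
        rw [mem_comap, map_mul, map_inv, ← e, mul_inv_cancel_right]
        exact hm
      intro y hy
      obtain ⟨x, rfl⟩ := hf y
      rw [hc] at h1
      exact h1 hy
  · refine le_frattiniPCore_of_nongenerating (hc ▸ comap_mono frattiniPCore_le) fun M hM h => ?_
    have h1 : pCore p Y ≤ M.map f := by
      refine frattiniPCore_nongenerating ?_ fun y hy => ?_
      · rw [map_le_iff_le_comap, ← hc]
        exact hM
      · obtain ⟨x, rfl⟩ := hf y
        have hx : x ∈ pCore p X := by rw [hc]; exact hy
        obtain ⟨m, hm, u, hu, rfl⟩ := mem_sup_of_normal_right.1 (h hx)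
        rw [map_mul]
        exact mul_mem (mem_sup_left ⟨m, hm, rfl⟩) (mem_sup_right hu)
    refine frattiniPCore_nongenerating hM fun x hx => ?_
    have hx' := hx
    rw [hc] at hx'
    obtain ⟨m, hm, e⟩ := h1 hx'
    have h2 : x = m * (m⁻¹ * x) := by group
    rw [h2]
    refine mul_mem (mem_sup_left hm) (mem_sup_right (hk ?_))
    rw [MonoidHom.mem_ker, map_mul, map_inv, e, inv_mul_cancel]

theorem isNormalIn_iff {N H : Subgroup X} :
    IsNormalIn N H ↔ N ≤ H ∧ H ≤ normalizer (N : Set X) := by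
  constructor
  · rintro ⟨h1, h2⟩
    refine ⟨h1, mem_normalizer_of_conj_mem fun h hh n hn => ?_⟩
    exact h2.conj_mem ⟨n, h1 hn⟩ hn ⟨h, hh⟩
  · rintro ⟨h1, h2⟩
    refine ⟨h1, ⟨fun n hn h => ?_⟩⟩
    exact conj_mem_of_le_normalizer h2 h.2 hn

theorem exists_maximal_invariant [Finite X] {H A B : Subgroup X} (hBA : B < A)
    (hB : H ≤ normalizer (B : Set X)) :
    ∃ C, B ≤ C ∧ Maximal (fun C : Subgroup X => C < A ∧ H ≤ normalizer (C : Set X)) C := by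
  exact (Set.toFinite {C : Subgroup X | C < A ∧ H ≤ normalizer (C : Set X)}).exists_le_maximal
    ⟨hBA, hB⟩

theorem invariantMelnikov_lt [Finite X] {H A : Subgroup X} (hA : A ≠ ⊥) :
    invariantMelnikov H A < A := by
  obtain ⟨C, -, hC⟩ := exists_maximal_invariant (H := H) (bot_lt_iff_ne_bot.2 hA)
    (mem_normalizer_of_conj_mem (by
      rintro h - x hx
      rw [mem_bot] at hx ⊢
      rw [hx]; group))
  have hle : invariantMelnikov H A ≤ C := sInf_le hC
  exact hle.trans_lt hC.1.1

/-- A subgroup normalized by `H` that covers `A` modulo `M_H(A)` contains `A`. -/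
theorem le_of_le_sup_invariantMelnikov [Finite X] {H A L K : Subgroup X}
    (hHA : H ≤ normalizer (A : Set X)) (hL : H ≤ normalizer (L : Set X)) [K.Normal]
    (hK : K ≤ invariantMelnikov H A) (h : A ≤ L ⊔ K) : A ≤ L := by
  by_contra hcon
  have hlt : L ⊓ A < A := lt_of_le_of_ne inf_le_right fun e => hcon (e ▸ inf_le_left)
  -- C contains both L ∩ A and K, and A = (L ∩ A)K because K ≤ A; this contradicts C < A.
  obtain ⟨C, hC, hCmax⟩ := exists_maximal_invariant hlt
    (mem_normalizer_of_conj_mem (H := H) fun g hg l hl => mem_inf.2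
      ⟨conj_mem_of_le_normalizer hL hg (mem_inf.1 hl).1,
        conj_mem_of_le_normalizer hHA hg (mem_inf.1 hl).2⟩)
  have hKC : K ≤ C := hK.trans (sInf_le hCmax)
  refine hCmax.1.1.not_ge fun a ha => ?_
  obtain ⟨l, hl, k, hk, rfl⟩ := mem_sup_of_normal_right.1 (h ha)
  have hkA : k ∈ A := hCmax.1.1.le (hKC hk)
  refine C.mul_mem (hC (mem_inf.2 ⟨hl, ?_⟩)) (hKC hk)
  have := A.mul_mem ha (A.inv_mem hkA)
  rwa [mul_inv_cancel_right] at this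

end FrattiniPCore

/-! ### Criteria for hereditarily just infinite and virtually pro-p groups. -/

section HereditarilyJustInfinite

variable {G : Type u} [Group G] [TopologicalSpace G]

theorem IsProfiniteGroup.subgroup (hG : IsProfiniteGroup G) {H : Subgroup G}
    (hH : IsClosed (H : Set G)) : IsProfiniteGroup H := by
  obtain ⟨h1, h2, h3, h4⟩ := hG
  exact ⟨inferInstance, isCompact_iff_compactSpace.1 hH.isCompact, inferInstance, inferInstance⟩

theorem isJustInfinite_of_isOpen (hG : IsProfiniteGroup G) [Infinite G] {H : Subgroup G}
    (hH : IsOpen (H : Set G))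
    (h : ∀ L : Subgroup G, IsClosed (L : Set G) → L ≠ ⊥ → H ≤ normalizer (L : Set G) →
      IsOpen (L : Set G)) : IsJustInfinite H := by
  have := hG.isTopologicalGroup
  have := hG.compactSpace
  have hHc : IsClosed (H : Set G) := H.isClosed_of_isOpen hH
  refine ⟨hG.subgroup hHc, ?_, fun N hN hNn hN1 => ?_⟩
  · by_contra hfin
    rw [not_infinite_iff_finite] at hfin
    have := finite_of_isOpen_of_finite hH hfin
    exact not_finite G
  · have h1 : IsOpen ((N.map H.subtype : Subgroup G) : Set G) := by
      refine h _ (hHc.isClosedEmbedding_subtypeVal.isClosedMap _ hN) ?_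
        (mem_normalizer_of_conj_mem ?_)
      · rwa [Ne, map_eq_bot_iff_of_injective _ H.subtype_injective]
      · rintro g hg _ ⟨n, hn, rfl⟩
        exact ⟨_, hNn.conj_mem n hn ⟨g, hg⟩, rfl⟩
    have h2 := finiteIndex_of_isOpen h1
    have h3 : ((N.map H.subtype).subgroupOf H).FiniteIndex := inferInstance
    rwa [subgroupOf, comap_map_eq_self_of_injective H.subtype_injective] at h3

theorem isHereditarilyJustInfinite_of_isOpen (hG : IsProfiniteGroup G) [Infinite G]
    (h : ∀ H L : Subgroup G, IsOpen (H : Set G) → IsClosed (L : Set G) → L ≠ ⊥ →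
      H ≤ normalizer (L : Set G) → IsOpen (L : Set G)) : IsHereditarilyJustInfinite G := by
  have := hG.isTopologicalGroup
  have := hG.compactSpace
  refine ⟨⟨hG, inferInstance, fun N hN hNn hN1 => ?_⟩, fun H hH =>
    isJustInfinite_of_isOpen hG hH fun L => h H L hH⟩
  exact finiteIndex_of_isOpen (h ⊤ N isOpen_univ hN hN1 (normalizer_eq_top_iff.2 hNn).ge)

theorem isVirtuallyProPGroup_of_isProPIn {p : ℕ} [Fact p.Prime] (hG : IsProfiniteGroup G)
    {O : Subgroup G} (hO : IsOpen (O : Set G)) (h : IsProPIn p O) : IsVirtuallyProPGroup p G := by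
  have := hG.isTopologicalGroup
  have := hG.compactSpace
  refine ⟨hG, O, hO, hG.subgroup (O.isClosed_of_isOpen hO), fun N hN hNn => ?_⟩
  have hNG : IsOpen ((N.map O.subtype : Subgroup G) : Set G) :=
    hO.isOpenEmbedding_subtypeVal.isOpenMap _ hN
  have hNGfi := finiteIndex_of_isOpen hNG
  have hNfi : ((N.map O.subtype).subgroupOf O).FiniteIndex := inferInstance
  rw [subgroupOf, comap_map_eq_self_of_injective O.subtype_injective] at hNfi
  have hp : IsPGroup p (O ⧸ N) := by
    intro g
    obtain ⟨g, rfl⟩ := QuotientGroup.mk_surjective g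
    obtain ⟨k, hk⟩ := h _ (isOpen_normalCore hNG) inferInstance g g.2
    refine ⟨k, ?_⟩
    rw [← QuotientGroup.mk_pow, QuotientGroup.eq_one_iff]
    obtain ⟨n, hn, e⟩ := normalCore_le _ hk
    have : n = g ^ p ^ k := Subtype.ext e
    rwa [← this]
  exact IsPGroup.iff_card.1 hp

end HereditarilyJustInfinite

/-! ### The limit of an admissible system. -/

namespace FiniteInverseSystem

variable (Λ : FiniteInverseSystem.{u})

/-- The projection of the limit to the `n`-th group. -/
def proj (n : ℕ) : Λ.limit →* Λ.G n := (Pi.evalMonoidHom Λ.G n).comp Λ.limit.subtype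

theorem rho_proj (n : ℕ) (x : Λ.limit) : Λ.ρ n (Λ.proj (n + 1) x) = Λ.proj n x := x.2 n

theorem ext_proj {x y : Λ.limit} (h : ∀ n, Λ.proj n x = Λ.proj n y) : x = y :=
  Subtype.ext (funext h)

theorem continuous_proj (n : ℕ) : Continuous (Λ.proj n) :=
  (continuous_apply n).comp continuous_subtype_val

instance (n : ℕ) : IsTopologicalGroup (Λ.G n) where
  continuous_mul := continuous_of_discreteTopology
  continuous_inv := continuous_of_discreteTopology

theorem isClosed_limit : IsClosed (Λ.limit : Set (∀ n, Λ.G n)) := by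
  have : (Λ.limit : Set (∀ n, Λ.G n)) = ⋂ n, {x | Λ.ρ n (x (n + 1)) = x n} := by
    ext x
    simp only [Set.mem_iInter]
    rfl
  rw [this]
  refine isClosed_iInter fun n => isClosed_eq ?_ (continuous_apply n)
  exact (continuous_of_discreteTopology (f := Λ.ρ n)).comp (continuous_apply (n + 1))

theorem isProfiniteGroup_limit : IsProfiniteGroup Λ.limit :=
  ⟨inferInstance, isCompact_iff_compactSpace.1 Λ.isClosed_limit.isCompact, inferInstance,
    inferInstance⟩

instance : CompactSpace Λ.limit := Λ.isProfiniteGroup_limit.compactSpace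

/-- A thread that is trivial up to `n` and continues a given element of the kernel of `ρ n`. -/
noncomputable def threadOfKer (n : ℕ) (k : Λ.G (n + 1)) : ∀ m, Λ.G m
  | 0 => 1
  | m + 1 => if h : m = n then h ▸ k else if m < n then 1 else
      Function.surjInv (Λ.surjective m) (threadOfKer n k m)

theorem threadOfKer_of_le {n : ℕ} (k : Λ.G (n + 1)) {m : ℕ} (hm : m ≤ n) :
    Λ.threadOfKer n k m = 1 := by
  cases m with
  | zero => rfl
  | succ m => rw [threadOfKer, dif_neg (by omega), if_pos (by omega)]

theorem proj_surjective (n : ℕ) : Function.Surjective (Λ.proj n) := by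
  induction n with
  | zero =>
    intro x
    let y : ∀ m, Λ.G m := fun m => Nat.rec x (fun m z => Function.surjInv (Λ.surjective m) z) m
    exact ⟨⟨y, fun m => Function.surjInv_eq (Λ.surjective m) (y m)⟩, rfl⟩
  | succ n ih =>
    intro x
    obtain ⟨z, hz⟩ := ih (Λ.ρ n x)
    -- A thread z lifting ρ x differs from x at level n + 1 by a kernel element, corrected by a
    -- thread trivial up to level n.
    set k := (Λ.proj (n + 1) z)⁻¹ * x with hk
    have hk1 : Λ.ρ n k = 1 := by rw [hk, map_mul, map_inv, rho_proj, hz, inv_mul_cancel]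
    have hw : Λ.threadOfKer n k ∈ Λ.limit := by
      intro m
      rcases lt_trichotomy m n with h | rfl | h
      · rw [Λ.threadOfKer_of_le k h.le, Λ.threadOfKer_of_le k h, map_one]
      · rw [Λ.threadOfKer_of_le k le_rfl, threadOfKer, dif_pos rfl]
        exact hk1
      · rw [threadOfKer, dif_neg (by omega), if_neg (by omega),
          Function.surjInv_eq (Λ.surjective m)]
    refine ⟨z * ⟨_, hw⟩, ?_⟩
    have h1 : Λ.proj (n + 1) ⟨_, hw⟩ = k := by
      change Λ.threadOfKer n k (n + 1) = k
      rw [threadOfKer, dif_pos rfl]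
    rw [map_mul, h1, hk, mul_inv_cancel_left]

theorem isOpen_comap_proj (n : ℕ) (H : Subgroup (Λ.G n)) :
    IsOpen (H.comap (Λ.proj n) : Set Λ.limit) :=
  (isOpen_discrete (H : Set (Λ.G n))).preimage (Λ.continuous_proj n)

theorem isOpen_ker_proj (n : ℕ) : IsOpen ((Λ.proj n).ker : Set Λ.limit) :=
  Λ.isOpen_comap_proj n ⊥

theorem ker_proj_antitone : Antitone fun n => (Λ.proj n).ker := by
  refine antitone_nat_of_succ_le fun n x hx => ?_
  rw [MonoidHom.mem_ker] at hx ⊢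
  rw [← rho_proj, hx, map_one]

/-- Compactness: the kernels are closed, nested and meet in 1. The bound m allows the level to be
chosen as deep as needed. -/
theorem exists_ker_proj_subset {U : Set Λ.limit} (hU : IsOpen U) (h1 : (1 : Λ.limit) ∈ U) (m : ℕ) :
    ∃ n ≥ m, ((Λ.proj n).ker : Set Λ.limit) ⊆ U := by
  obtain ⟨n, hn⟩ := exists_subset_nhds_of_compactSpace
    (V := fun n => ((Λ.proj n).ker : Set Λ.limit))
    (directed_of_isDirected_le fun a b h => Λ.ker_proj_antitone h)
    (fun n => isClosed_of_isOpen _ (Λ.isOpen_ker_proj n)) (U := U) (by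
      intro x hx
      have : x = 1 := Λ.ext_proj fun n => by
        rw [map_one]; exact Set.mem_iInter.1 hx n
      rw [this]
      exact hU.mem_nhds h1)
  exact ⟨max n m, le_max_right _ _, fun x hx => hn (Λ.ker_proj_antitone (le_max_left n m) hx)⟩

theorem exists_ker_proj_le {S : Subgroup Λ.limit} (hS : IsOpen (S : Set Λ.limit)) :
    ∃ n, (Λ.proj n).ker ≤ S := by
  obtain ⟨n, -, hn⟩ := Λ.exists_ker_proj_subset hS S.one_mem 0
  exact ⟨n, hn⟩

namespace IsAdmissible

variable {Λ} {p : ℕ} [Fact p.Prime] {A : ∀ n, Subgroup (Λ.G n)}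

theorem A_le (h : Λ.IsAdmissible p A) (n : ℕ) : A n ≤ Λ.F p n := (h.isNormalIn n).1

theorem ker_le_A (h : Λ.IsAdmissible p A) (n : ℕ) : (Λ.ρ n).ker ≤ A (n + 1) :=
  (h.ker_le n).trans (invariantMelnikov_lt (h.ne_bot _)).le

theorem pCore_succ (h : Λ.IsAdmissible p A) (n : ℕ) :
    pCore p (Λ.G (n + 1)) = (pCore p (Λ.G n)).comap (Λ.ρ n) :=
  pCore_eq_comap (Λ.surjective n)
    (isPGroup_pCore.to_le ((h.ker_le_A n).trans ((h.A_le _).trans frattiniPCore_le)))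

theorem comap_proj_pCore (h : Λ.IsAdmissible p A) (n : ℕ) :
    (pCore p (Λ.G n)).comap (Λ.proj n) = (pCore p (Λ.G 0)).comap (Λ.proj 0) := by
  induction n with
  | zero => rfl
  | succ n ih =>
    rw [← ih, h.pCore_succ, comap_comap]
    congr 1
    ext x
    exact Λ.rho_proj n x

theorem comap_proj_F (h : Λ.IsAdmissible p A) (n : ℕ) :
    (Λ.F p n).comap (Λ.proj n) = (Λ.F p 0).comap (Λ.proj 0) := by
  induction n with
  | zero => rfl
  | succ n ih =>
    rw [← ih, h.F_succ, comap_comap]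
    congr 1
    ext x
    exact Λ.rho_proj n x

theorem P_ne_bot (h : Λ.IsAdmissible p A) (n : ℕ) : Λ.P A n ≠ ⊥ := by
  intro e
  rw [P, Subgroup.map_eq_bot_iff] at e
  exact (invariantMelnikov_lt (H := Λ.F p (n + 1)) (h.ne_bot _)).not_ge (e.trans (h.ker_le n))

theorem infinite_limit (h : Λ.IsAdmissible p A) : Infinite Λ.limit := by
  by_contra hfin
  rw [not_infinite_iff_finite] at hfin
  obtain ⟨n, hn⟩ := Λ.exists_ker_proj_le (S := ⊥) (isOpen_discrete _)
  have hk : (Λ.ρ n).ker ≠ ⊥ := fun e => h.P_ne_bot (n + 1) (le_bot_iff.1 (e ▸ h.le_ker n))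
  obtain ⟨y, hy, hy1⟩ := ((Λ.ρ n).ker.bot_or_exists_ne_one).resolve_left hk
  obtain ⟨z, rfl⟩ := Λ.proj_surjective (n + 1) y
  rw [MonoidHom.mem_ker, rho_proj] at hy
  have := hn hy
  rw [mem_bot] at this
  exact hy1 (by rw [this, map_one])

/-- A nontrivial closed normal subgroup of the preimage of `F` contains the kernel of a projection. -/
theorem exists_ker_le (h : Λ.IsAdmissible p A) {L : Subgroup Λ.limit}
    (hL : IsClosed (L : Set Λ.limit)) (hL1 : L ≠ ⊥) (hLF : L ≤ (Λ.F p 0).comap (Λ.proj 0))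
    (hn : (Λ.F p 0).comap (Λ.proj 0) ≤ normalizer (L : Set Λ.limit)) :
    ∃ n, (Λ.proj n).ker ≤ L := by
  have hLn : ∀ n, L.map (Λ.proj n) ≤ Λ.F p n := by
    intro n
    rw [map_le_iff_le_comap, h.comap_proj_F]
    exact hLF
  have hLnorm : ∀ n, Λ.F p n ≤ normalizer (L.map (Λ.proj n) : Set (Λ.G n)) := by
    intro n
    refine mem_normalizer_of_conj_mem ?_
    rintro g hg _ ⟨l, hl, rfl⟩
    obtain ⟨g, rfl⟩ := Λ.proj_surjective n g
    have hg' : g ∈ (Λ.F p n).comap (Λ.proj n) := hg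
    rw [h.comap_proj_F] at hg'
    exact ⟨_, conj_mem_of_le_normalizer hn hg' hl, by simp⟩
  obtain ⟨l, hl, hl1⟩ := (L.bot_or_exists_ne_one).resolve_left hL1
  obtain ⟨m, hm⟩ : ∃ m, Λ.proj m l ≠ 1 := by
    by_contra hcon
    push Not at hcon
    exact hl1 (Λ.ext_proj fun n => by rw [hcon, map_one])
  have hml : ∀ n ≥ m, Λ.proj n l ≠ 1 := fun n hn e => hm (Λ.ker_proj_antitone hn e)
  -- The shift by 2 pays for two projections: an image inside A at level n + 2 lies in P at level n
  -- + 1 and is trivial at level n ≥ m, where l survives.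
  have hP : ∀ n ≥ m + 2, Λ.P A n ≤ L.map (Λ.proj n) := by
    intro n hn
    obtain ⟨n, rfl⟩ := Nat.exists_eq_add_of_le' (show 2 ≤ n by omega)
    refine (h.le_or_le (n + 2) _ (isNormalIn_iff.2 ⟨hLn _, hLnorm _⟩)).resolve_right fun hcon => ?_
    have h1 : Λ.proj (n + 1) l ∈ Λ.P A (n + 1) := by
      rw [← rho_proj]
      exact mem_map_of_mem _ (hcon (mem_map_of_mem _ hl))
    have h2 := h.le_ker n h1
    rw [MonoidHom.mem_ker, rho_proj] at h2
    exact hml n (by omega) h2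
  have hA : ∀ n ≥ m + 2, A (n + 1) ≤ L.map (Λ.proj (n + 1)) := by
    intro n hn
    refine le_of_le_sup_invariantMelnikov (isNormalIn_iff.1 (h.isNormalIn (n + 1))).2 (hLnorm _)
      (h.ker_le n) fun a ha => ?_
    obtain ⟨x, hx, e⟩ := hP n hn (mem_map_of_mem _ ha)
    have h1 : a = Λ.proj (n + 1) x * ((Λ.proj (n + 1) x)⁻¹ * a) := by group
    rw [h1]
    refine mul_mem (mem_sup_left (mem_map_of_mem _ hx)) (mem_sup_right ?_)
    rw [MonoidHom.mem_ker, map_mul, map_inv, rho_proj, e, inv_mul_cancel]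
  refine ⟨m + 2, fun x hx => ?_⟩
  -- Since A (n + 1), hence the kernel of ρ n, lies in the image of L, an element matching x at
  -- level n can be corrected at level n + 1. Closedness of L then puts x in L.
  have hxm : ∀ n ≥ m + 2, Λ.proj n x ∈ L.map (Λ.proj n) := by
    intro n hn
    induction n, hn using Nat.le_induction with
    | base =>
      rw [MonoidHom.mem_ker.1 hx]
      exact one_mem _
    | succ n hn ih =>
      obtain ⟨y, hy, e⟩ := ih
      have h1 : Λ.proj (n + 1) x = Λ.proj (n + 1) y * Λ.proj (n + 1) (y⁻¹ * x) := by
        rw [← map_mul, mul_inv_cancel_left]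
      rw [h1]
      refine mul_mem (mem_map_of_mem _ hy) (hA n hn (h.ker_le_A n ?_))
      rw [MonoidHom.mem_ker, rho_proj, map_mul, map_inv, e, inv_mul_cancel]
  by_contra hxL
  obtain ⟨n, hn, hsub⟩ := Λ.exists_ker_proj_subset (U := (fun y => x * y) ⁻¹' (L : Set Λ.limit)ᶜ)
    (hL.isOpen_compl.preimage (by fun_prop)) (by simpa using hxL) (m + 2)
  obtain ⟨y, hy, e⟩ := hxm n hn
  have h1 : x⁻¹ * y ∈ (Λ.proj n).ker := by
    rw [MonoidHom.mem_ker, map_mul, map_inv, e, inv_mul_cancel]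
  have h2 := hsub h1
  simp only [Set.mem_preimage, mul_inv_cancel_left, Set.mem_compl_iff, SetLike.mem_coe] at h2
  exact h2 hy

theorem isJustInfiniteFrattini (h : Λ.IsAdmissible p A) :
    IsJustInfiniteFrattini p ((pCore p (Λ.G 0)).comap (Λ.proj 0)) ((Λ.F p 0).comap (Λ.proj 0)) where
  isOpen_left := Λ.isOpen_comap_proj _ _
  isOpen_right := Λ.isOpen_comap_proj _ _
  le := comap_mono frattiniPCore_le
  normal := (frattiniPCore_normal (p := p) (X := Λ.G 0)).comap _
  isProPIn := by
    intro N hN _ d hd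
    obtain ⟨n, hn⟩ := Λ.exists_ker_proj_le hN
    rw [← h.comap_proj_pCore n] at hd
    obtain ⟨k, hk⟩ := isPGroup_pCore (p := p) ⟨_, hd⟩
    refine ⟨k, hn ?_⟩
    rw [MonoidHom.mem_ker, map_pow]
    exact congrArg Subtype.val hk
  nongenerating := by
    intro S hS hSO hle
    obtain ⟨n, hn⟩ := Λ.exists_ker_proj_le hS
    rw [← h.comap_proj_pCore n] at hSO hle ⊢
    rw [← h.comap_proj_F n] at hle
    have h1 : pCore p (Λ.G n) ≤ S.map (Λ.proj n) := by
      refine frattiniPCore_nongenerating (map_le_iff_le_comap.2 hSO) fun y hy => ?_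
      obtain ⟨x, rfl⟩ := Λ.proj_surjective n y
      have := mem_map_of_mem (Λ.proj n) (hle hy)
      rw [Subgroup.map_sup] at this
      exact sup_le_sup_left (map_comap_le _ _) _ this
    intro x hx
    obtain ⟨s, hs, e⟩ := h1 hx
    have h2 : x = s * (s⁻¹ * x) := by group
    rw [h2]
    refine S.mul_mem hs (hn ?_)
    rw [MonoidHom.mem_ker, map_mul, map_inv, e, inv_mul_cancel]
  isOpen_of_le := by
    intro L hL hL1 hLF hn
    obtain ⟨n, hn⟩ := h.exists_ker_le hL hL1 hLF hn
    exact isOpen_mono hn (Λ.isOpen_ker_proj n)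
  inf_ne_bot := by
    intro K _ hK hK1 hKF
    have hKn : (K.map (Λ.proj 0)).Normal := hK.map _ (Λ.proj_surjective 0)
    -- Either K lies in the kernel of the first projection, which is inside F, or its image contains
    -- a minimal normal subgroup and (iv) applies.
    by_cases hbot : K.map (Λ.proj 0) = ⊥
    · apply hK1
      rw [← hKF, left_eq_inf]
      rw [Subgroup.map_eq_bot_iff] at hbot
      exact hbot.trans (fun x hx => by rw [mem_comap, MonoidHom.mem_ker.1 hx]; exact one_mem _)
    · obtain ⟨M, hMK, hM⟩ := (Set.toFinite
        {M : Subgroup (Λ.G 0) | M.Normal ∧ M ≠ ⊥}).exists_le_minimal ⟨hKn, hbot⟩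
      obtain ⟨y, hy, hy1⟩ := (M.bot_or_exists_ne_one).resolve_left hM.1.2
      obtain ⟨k, hk, rfl⟩ := hMK hy
      have : k ∈ K ⊓ (Λ.F p 0).comap (Λ.proj 0) :=
        mem_inf.2 ⟨hk, h.minimal_normal_le M hM hy⟩
      rw [hKF, mem_bot] at this
      exact hy1 (by rw [this, map_one])

theorem isHereditarilyJustInfinite (h : Λ.IsAdmissible p A) : IsHereditarilyJustInfinite Λ.limit := by
  have := h.infinite_limit
  exact isHereditarilyJustInfinite_of_isOpen Λ.isProfiniteGroup_limit fun H L hH hL hL1 hn =>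
    h.isJustInfiniteFrattini.isOpen_of_isOpen_le_normalizer hH hL hL1 hn

theorem isVirtuallyProPGroup (h : Λ.IsAdmissible p A) : IsVirtuallyProPGroup p Λ.limit :=
  isVirtuallyProPGroup_of_isProPIn Λ.isProfiniteGroup_limit
    h.isJustInfiniteFrattini.isOpen_left h.isJustInfiniteFrattini.isProPIn

end IsAdmissible

end FiniteInverseSystem

/-! ### Maps between quotients of one group. -/

section Quotient

variable {G : Type*} [Group G]

theorem ker_quotientGroup_map_id {N M : Subgroup G} [N.Normal] [M.Normal] (h : N ≤ M) :
    (QuotientGroup.map N M (MonoidHom.id G) h).ker = M.map (QuotientGroup.mk' N) := by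
  ext x
  obtain ⟨g, rfl⟩ := QuotientGroup.mk'_surjective N x
  rw [MonoidHom.mem_ker]
  constructor
  · intro hg
    exact ⟨g, (QuotientGroup.eq_one_iff (N := M) g).1 hg, rfl⟩
  · rintro ⟨m, hm, e⟩
    rw [← e]
    exact (QuotientGroup.eq_one_iff (N := M) m).2 hm

theorem quotientGroup_map_id_surjective {N M : Subgroup G} [N.Normal] [M.Normal] (h : N ≤ M) :
    Function.Surjective (QuotientGroup.map N M (MonoidHom.id G) h) := by
  intro x
  obtain ⟨g, rfl⟩ := QuotientGroup.mk'_surjective M x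
  exact ⟨QuotientGroup.mk' N g, rfl⟩

end Quotient

/-! ### Open Frattini subgroups and obliquity in hereditarily just infinite groups. -/

section Converse

variable {G : Type u} [Group G] [TopologicalSpace G]

theorem IsHereditarilyJustInfinite.isOpen_of_le [IsTopologicalGroup G]
    (hG : IsHereditarilyJustInfinite G) [CompactSpace G]
    {H L : Subgroup G} (hH : IsOpen (H : Set G)) (hL : IsClosed (L : Set G)) (hLH : L ≤ H)
    (hL1 : L ≠ ⊥) (hn : H ≤ normalizer (L : Set G)) : IsOpen (L : Set G) := by
  have h1 : (L.subgroupOf H).FiniteIndex := by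
    refine (hG.of_isOpen H hH).finiteIndex _ (hL.preimage continuous_subtype_val) ?_ ?_
    · exact ⟨fun l hl g => conj_mem_of_le_normalizer hn g.2 hl⟩
    · intro e
      rw [subgroupOf_eq_bot, disjoint_iff, inf_eq_left.2 hLH] at e
      exact hL1 e
  have h2 := finiteIndex_of_isOpen hH
  have h3 : L.FiniteIndex := ⟨by
    rw [← relIndex_mul_index hLH]
    exact mul_ne_zero h1.index_ne_zero h2.index_ne_zero⟩
  exact L.isOpen_of_isClosed_of_finiteIndex hL

variable [IsTopologicalGroup G] [CompactSpace G] [T2Space G]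

theorem IsProPIn.mono {p : ℕ} {C D : Subgroup G} (h : IsProPIn p D) (hCD : C ≤ D) : IsProPIn p C :=
  fun N hN hNn d hd => h N hN hNn d (hCD hd)

theorem IsProPIn.isPGroup_map {p : ℕ} {D N : Subgroup G} (hD : IsProPIn p D) (hN : IsOpen (N : Set G))
    [N.Normal] : IsPGroup p (D.map (QuotientGroup.mk' N)) := by
  rintro ⟨_, d, hd, rfl⟩
  obtain ⟨k, hk⟩ := hD N hN inferInstance d hd
  refine ⟨k, Subtype.ext ?_⟩
  have h1 : QuotientGroup.mk' N (d ^ p ^ k) = 1 := (QuotientGroup.eq_one_iff _).2 hk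
  rwa [map_pow] at h1

/-- An open pro-`p` subgroup `D` of a hereditarily just infinite group has an open Frattini subgroup;
it contains an open normal subgroup of the whole group. -/
theorem IsHereditarilyJustInfinite.exists_nongenerating {p : ℕ} [Fact p.Prime]
    (hG : IsHereditarilyJustInfinite G) {D : Subgroup G} (hD : IsOpen (D : Set G))
    (hp : IsProPIn p D) :
    ∃ N : Subgroup G, IsOpen (N : Set G) ∧ N.Normal ∧ N ≤ D ∧
      ∀ L : Subgroup G, IsOpen (L : Set G) → L ≤ D → D ≤ L ⊔ N → D ≤ L := by
  have hinf := hG.justInfinite.infinite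
  set s : Set G := {x | ∃ d ∈ D, x = d ^ p} ∪ {x | ∃ d ∈ D, ∃ e ∈ D, x = d * e * d⁻¹ * e⁻¹} with hs
  set S := (Subgroup.closure s) with hS
  have hsD : S ≤ D := by
    rw [hS, closure_le]
    rintro _ (⟨d, hd, rfl⟩ | ⟨d, hd, e, he, rfl⟩)
    · exact D.pow_mem hd p
    · exact D.mul_mem (D.mul_mem (D.mul_mem hd he) (D.inv_mem hd)) (D.inv_mem he)
  have hSn : ∀ g ∈ D, ∀ l ∈ S, g * l * g⁻¹ ∈ S := by
    intro g hg
    have hle : S ≤ S.comap (MulAut.conj g).toMonoidHom := by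
      rw [hS, closure_le]
      rintro _ (⟨d, hd, rfl⟩ | ⟨d, hd, e, he, rfl⟩)
      · refine Subgroup.subset_closure (Or.inl ⟨g * d * g⁻¹, ?_, by simp [conj_pow]⟩)
        exact D.mul_mem (D.mul_mem hg hd) (D.inv_mem hg)
      · refine Subgroup.subset_closure (Or.inr ⟨g * d * g⁻¹, ?_, g * e * g⁻¹, ?_, ?_⟩)
        · exact D.mul_mem (D.mul_mem hg hd) (D.inv_mem hg)
        · exact D.mul_mem (D.mul_mem hg he) (D.inv_mem hg)
        · simp only [MulEquiv.toMonoidHom_eq_coe, MonoidHom.coe_coe, MulAut.conj_apply]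
          group
    exact hle
  have hDcl := D.isClosed_of_isOpen hD
  -- Otherwise D is abelian of exponent dividing p, and ⟨d⟩ for d ≠ 1 is finite and normal in D,
  -- hence open, so G is finite.
  have hΨ1 : S.topologicalClosure ≠ ⊥ := by
    intro e
    have hS1 : ∀ x ∈ s, x = 1 := by
      intro x hx
      have := S.le_topologicalClosure (Subgroup.subset_closure hx)
      rwa [e, mem_bot] at this
    have hD1 : D ≠ ⊥ := by
      rintro rfl
      have := finite_of_isOpen_of_finite hD inferInstance
      exact not_finite G
    obtain ⟨d, hd, hd1⟩ := (D.bot_or_exists_ne_one).resolve_left hD1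
    have hdfin : Finite (zpowers d) := by
      have : IsOfFinOrder d := isOfFinOrder_iff_pow_eq_one.2
        ⟨p, (Fact.out : p.Prime).pos, hS1 _ (Or.inl ⟨d, hd, rfl⟩)⟩
      exact this.finite_zpowers
    have := finite_of_isOpen_of_finite (hG.isOpen_of_le hD
      (Set.toFinite (zpowers d : Set G)).isClosed (by rwa [zpowers_le]) (by
        rwa [Ne, zpowers_eq_bot]) (mem_normalizer_of_conj_mem fun g hg l hl => by
          have hlD : l ∈ D := (zpowers_le.2 hd) hl
          have h1 := hS1 _ (Or.inr ⟨g, hg, l, hlD, rfl⟩)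
          rwa [mul_inv_eq_one.1 h1])) hdfin
    exact not_finite G
  have hΨo : IsOpen (S.topologicalClosure : Set G) :=
    hG.isOpen_of_le hD S.isClosed_topologicalClosure (S.topologicalClosure_minimal hsD hDcl) hΨ1
      (le_normalizer_topologicalClosure hSn)
  refine ⟨S.topologicalClosure.normalCore, isOpen_normalCore hΨo, inferInstance,
    (normalCore_le _).trans (S.topologicalClosure_minimal hsD hDcl), fun L hL hLD hLN => ?_⟩
  set V := L.normalCore with hV
  have hVo : IsOpen (V : Set G) := isOpen_normalCore hL
  have hfin : Finite (G ⧸ V) := V.quotient_finite_of_isOpen hVo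
  set f := QuotientGroup.mk' V with hf
  have hfker : ∀ g, f g = 1 ↔ g ∈ V := fun g => QuotientGroup.eq_one_iff g
  set X := D.map f with hX
  have hXp : IsPGroup p X := hp.isPGroup_map hVo
  -- Modulo the core V of L, the Frattini subgroup of the finite p-group D/(D ∩ V) contains all p-th
  -- powers and commutators; its preimage is closed, so it contains the closure of S.
  set Φ := ((frattini X).map X.subtype).comap f with hΦ
  have hΦo : IsOpen (Φ : Set G) := by
    refine isOpen_mono (fun v hv => ?_) hVo
    rw [hΦ, mem_comap, (hfker v).2 hv]
    exact one_mem _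
  have hSΦ : S.topologicalClosure ≤ Φ := by
    refine S.topologicalClosure_minimal ?_ (Φ.isClosed_of_isOpen hΦo)
    rw [hS, closure_le]
    rintro _ (⟨d, hd, rfl⟩ | ⟨d, hd, e, he, rfl⟩)
    · exact ⟨_, hXp.pow_mem_frattini ⟨f d, mem_map_of_mem f hd⟩, by simp⟩
    · exact ⟨_, hXp.commutator_mem_frattini ⟨f d, mem_map_of_mem f hd⟩ ⟨f e, mem_map_of_mem f he⟩,
        by simp⟩
  have htop : (L.map f).subgroupOf X = ⊤ := by
    apply frattini_nongenerating
    rw [eq_top_iff]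
    rintro ⟨_, d, hd, rfl⟩ -
    obtain ⟨l, hl, n, hn, rfl⟩ := mem_sup_of_normal_right.1 (hLN hd)
    obtain ⟨x, hx, e⟩ := hSΦ (normalCore_le _ hn)
    have e2 : (⟨f (l * n), mem_map_of_mem f hd⟩ : X) =
        ⟨f l, mem_map_of_mem f (hLD hl)⟩ * x := by
      apply Subtype.ext
      change f (l * n) = f l * (x : G ⧸ V)
      rw [map_mul, ← e]
      rfl
    rw [e2]
    exact mul_mem (mem_sup_left (mem_subgroupOf.2 (mem_map_of_mem f hl))) (mem_sup_right hx)
  intro d hd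
  rw [subgroupOf_eq_top] at htop
  obtain ⟨l, hl, e⟩ := htop (mem_map_of_mem f hd)
  have h1 : l⁻¹ * d ∈ V := by
    rw [← hfker, map_mul, map_inv, e, inv_mul_cancel]
  have h2 : d = l * (l⁻¹ * d) := by group
  rw [h2]
  exact L.mul_mem hl (normalCore_le _ h1)

/-- Obliquity: given an open subgroup `A`, the open subgroups normalized by the open subgroup `H` and
contained in `H` but not in `A` all contain a common open normal subgroup. -/
theorem IsHereditarilyJustInfinite.exists_le_of_not_le {p : ℕ} [Fact p.Prime]
    (hG : IsHereditarilyJustInfinite G) {O : Subgroup G} (hO : IsOpen (O : Set G))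
    (hp : IsProPIn p O) {H A : Subgroup G} (hH : IsOpen (H : Set G)) (hA : IsOpen (A : Set G)) :
    ∃ Q : Subgroup G, IsOpen (Q : Set G) ∧ Q.Normal ∧ ∀ K : Subgroup G, IsOpen (K : Set G) →
      K ≤ H → H ≤ normalizer (K : Set G) → ¬ K ≤ A → Q ≤ K := by
  have hHcl := H.isClosed_of_isOpen hH
  have hcomp : IsCompact ((H : Set G) \ A) := (hHcl.sdiff hA).isCompact
  have key : ∃ Q : Subgroup G, IsOpen (Q : Set G) ∧ ∀ K : Subgroup G, IsOpen (K : Set G) →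
      K ≤ H → H ≤ normalizer (K : Set G) → ((K : Set G) ∩ ((H : Set G) \ A)).Nonempty → Q ≤ K := by
    -- Compactness of H \ A reduces to finding, near each x, one open Q contained in every
    -- admissible K that meets the neighbourhood.
    refine hcomp.induction_on (p := fun t => ∃ Q : Subgroup G, IsOpen (Q : Set G) ∧
      ∀ K : Subgroup G, IsOpen (K : Set G) → K ≤ H → H ≤ normalizer (K : Set G) →
        ((K : Set G) ∩ t).Nonempty → Q ≤ K) ?_ ?_ ?_ ?_
    · exact ⟨⊤, isOpen_univ, fun K _ _ _ h => absurd h (by simp)⟩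
    · rintro s t hst ⟨Q, hQ, h⟩
      exact ⟨Q, hQ, fun K h1 h2 h3 h4 => h K h1 h2 h3 (h4.mono (Set.inter_subset_inter_right _ hst))⟩
    · rintro s t ⟨Q, hQ, h⟩ ⟨R, hR, h'⟩
      refine ⟨Q ⊓ R, hQ.inter hR, fun K h1 h2 h3 h4 => ?_⟩
      rw [Set.inter_union_distrib_left, Set.union_nonempty] at h4
      rcases h4 with h4 | h4
      · exact inf_le_left.trans (h K h1 h2 h3 h4)
      · exact inf_le_right.trans (h' K h1 h2 h3 h4)
    · rintro x ⟨hxH, hxA⟩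
      set s : Set G := (fun g => g * x * g⁻¹) '' (H : Set G) with hs
      set S := Subgroup.closure s with hS
      have hxS : x ∈ S := Subgroup.subset_closure ⟨1, H.one_mem, by simp⟩
      have hSH : S ≤ H := by
        rw [hS, closure_le]
        rintro _ ⟨g, hg, rfl⟩
        exact H.mul_mem (H.mul_mem hg hxH) (H.inv_mem hg)
      have hSn : ∀ g ∈ H, ∀ l ∈ S, g * l * g⁻¹ ∈ S := by
        intro g hg
        have hle : S ≤ S.comap (MulAut.conj g).toMonoidHom := by
          rw [hS, closure_le]
          rintro _ ⟨h, hh, rfl⟩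
          refine Subgroup.subset_closure ⟨g * h, H.mul_mem hg hh, ?_⟩
          simp only [MulEquiv.toMonoidHom_eq_coe, MonoidHom.coe_coe, MulAut.conj_apply]
          group
        exact hle
      have hCo : IsOpen (S.topologicalClosure : Set G) := by
        refine hG.isOpen_of_le hH S.isClosed_topologicalClosure
          (S.topologicalClosure_minimal hSH hHcl) ?_ (le_normalizer_topologicalClosure hSn)
        intro e
        have := S.le_topologicalClosure hxS
        rw [e, mem_bot] at this
        exact hxA (this ▸ A.one_mem)
      -- Intersecting with O gives a pro-p group D. If K meets xN, then KN contains the closed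
      -- H-normal closure of x, hence D; nongeneration removes N, and N ≤ D ≤ K then puts the whole
      -- closure in K.
      obtain ⟨N, hN, hNn, hND, hgen⟩ := hG.exists_nongenerating (D := S.topologicalClosure ⊓ O)
        (hCo.inter hO) (hp.mono inf_le_right)
      refine ⟨(fun y => x⁻¹ * y) ⁻¹' (N : Set G), mem_nhdsWithin_of_mem_nhds
        ((hN.preimage (by fun_prop)).mem_nhds (by simp)), S.topologicalClosure, hCo, ?_⟩
      rintro K hK hKH hKn ⟨y, hyK, hy⟩
      have hKNo : IsOpen ((K ⊔ N : Subgroup G) : Set G) := isOpen_mono le_sup_left hK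
      have hxKN : x ∈ K ⊔ N := by
        have e : x = y * (x⁻¹ * y)⁻¹ := by group
        rw [e]
        exact mul_mem (mem_sup_left hyK) (mem_sup_right (N.inv_mem hy))
      have hCKN : S.topologicalClosure ≤ K ⊔ N := by
        refine S.topologicalClosure_minimal ?_ ((K ⊔ N).isClosed_of_isOpen hKNo)
        rw [hS, closure_le]
        rintro _ ⟨g, hg, rfl⟩
        obtain ⟨k, hk, n, hn, rfl⟩ := mem_sup_of_normal_right.1 hxKN
        have e : g * (k * n) * g⁻¹ = (g * k * g⁻¹) * (g * n * g⁻¹) := by group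
        simp only [e]
        exact mul_mem (mem_sup_left (conj_mem_of_le_normalizer hKn hg hk))
          (mem_sup_right (hNn.conj_mem n hn g))
      have hDK := hgen (K ⊓ (S.topologicalClosure ⊓ O)) (hK.inter (hCo.inter hO)) inf_le_right (by
        intro d hd
        obtain ⟨k, hk, n, hn, rfl⟩ := mem_sup_of_normal_right.1 (hCKN (mem_inf.1 hd).1)
        refine mul_mem (mem_sup_left (mem_inf.2 ⟨hk, ?_⟩)) (mem_sup_right hn)
        have := mul_mem hd (inv_mem (hND hn))
        rwa [mul_inv_cancel_right] at this)
      exact hCKN.trans (sup_le le_rfl (hND.trans (hDK.trans inf_le_left)))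
  obtain ⟨Q, hQ, h⟩ := key
  refine ⟨Q.normalCore, isOpen_normalCore hQ, inferInstance, fun K h1 h2 h3 h4 => ?_⟩
  obtain ⟨x, hx, hxA⟩ := SetLike.not_le_iff_exists.1 h4
  exact (normalCore_le _).trans (h K h1 h2 h3 ⟨x, hx, h2 hx, hxA⟩)

/-- The preimage `F` of `Φ(O_p(G/N))` does not depend on the sufficiently small open normal
subgroup `N`. -/
theorem IsHereditarilyJustInfinite.exists_frattini {p : ℕ} [Fact p.Prime]
    (hG : IsHereditarilyJustInfinite G) (hV : IsVirtuallyProPGroup p G) :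
    ∃ O F N₁ : Subgroup G, IsOpen (O : Set G) ∧ IsProPIn p O ∧ IsOpen (F : Set G) ∧ F.Normal ∧
      F ≤ O ∧ IsOpen (N₁ : Set G) ∧ N₁.Normal ∧ N₁ ≤ F ∧
      ∀ (N : Subgroup G) [N.Normal], IsOpen (N : Set G) → N ≤ N₁ →
        (frattiniPCore p (G ⧸ N)).comap (QuotientGroup.mk' N) = F := by
  obtain ⟨H, hH, hHp⟩ := hV.exists_open
  set K := H.normalCore with hK
  have hKo : IsOpen (K : Set G) := isOpen_normalCore hH
  have hKp : IsProPIn p K := by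
    intro N hN hNn d hd
    obtain ⟨k, hk⟩ := hHp.index_eq_pow (N.subgroupOf H) (hN.preimage continuous_subtype_val)
      inferInstance
    refine ⟨k, ?_⟩
    have := (N.subgroupOf H).pow_index_mem ⟨d, normalCore_le _ hd⟩
    rw [hk] at this
    exact this
  have hfin : ∀ N : Subgroup G, IsOpen (N : Set G) → Finite (G ⧸ N) := fun N hN =>
    N.quotient_finite_of_isOpen hN
  -- As K is pro-p, passing to N ≤ K leaves the preimage of O_p(G/N) unchanged. Inside N₁, which is
  -- nongenerating in O, the preimage of its Frattini subgroup stabilizes too.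
  set O := (pCore p (G ⧸ K)).comap (QuotientGroup.mk' K) with hO
  have hKO : K ≤ O := by
    intro g hg
    rw [hO, mem_comap, (QuotientGroup.eq_one_iff (N := K) g).2 hg |> (id : _ → QuotientGroup.mk' K g = 1)]
    exact one_mem _
  have hOo : IsOpen (O : Set G) := isOpen_mono hKO hKo
  have hcore : ∀ (N : Subgroup G) [N.Normal] (hN : IsOpen (N : Set G)) (hNK : N ≤ K),
      pCore p (G ⧸ N) = (pCore p (G ⧸ K)).comap (QuotientGroup.map N K (MonoidHom.id G) hNK) := by
    intro N _ hN hNK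
    have := hfin N hN
    have := hfin K hKo
    refine pCore_eq_comap (quotientGroup_map_id_surjective hNK) ?_
    rw [ker_quotientGroup_map_id]
    exact hKp.isPGroup_map hN
  have hOcore : ∀ (N : Subgroup G) [N.Normal] (hN : IsOpen (N : Set G)) (hNK : N ≤ K),
      (pCore p (G ⧸ N)).comap (QuotientGroup.mk' N) = O := by
    intro N _ hN hNK
    rw [hcore N hN hNK]
    rfl
  have hOp : IsProPIn p O := by
    intro N hN hNn d hd
    have hNK : IsOpen ((N ⊓ K : Subgroup G) : Set G) := hN.inter hKo
    have := hfin _ hNK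
    rw [← hOcore (N ⊓ K) hNK inf_le_right] at hd
    obtain ⟨k, hk⟩ := isPGroup_pCore (p := p) ⟨_, hd⟩
    have h1 : QuotientGroup.mk' (N ⊓ K) (d ^ p ^ k) = 1 := by
      rw [map_pow]
      exact congrArg Subtype.val hk
    exact ⟨k, ((QuotientGroup.eq_one_iff (N := N ⊓ K) _).1 h1).1⟩
  obtain ⟨N₀, hN₀, hN₀n, hN₀O, hgen⟩ := hG.exists_nongenerating hOo hOp
  set N₁ := N₀ ⊓ K with hN₁
  have hN₁o : IsOpen (N₁ : Set G) := hN₀.inter hKo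
  have hfin1 := hfin N₁ hN₁o
  set F := (frattiniPCore p (G ⧸ N₁)).comap (QuotientGroup.mk' N₁) with hF
  have hN₁F : N₁ ≤ F := by
    intro g hg
    rw [hF, mem_comap, (QuotientGroup.eq_one_iff (N := N₁) g).2 hg |> (id : _ → QuotientGroup.mk' N₁ g = 1)]
    exact one_mem _
  refine ⟨O, F, N₁, hOo, hOp, isOpen_mono hN₁F hN₁o, inferInstance, ?_, hN₁o, inferInstance, hN₁F, ?_⟩
  · rw [← hOcore N₁ hN₁o inf_le_right]
    exact comap_mono frattiniPCore_le
  · intro N _ hN hNN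
    have hfinN := hfin N hN
    have hNK : N ≤ K := hNN.trans inf_le_right
    have hc : pCore p (G ⧸ N) = (pCore p (G ⧸ N₁)).comap
        (QuotientGroup.map N N₁ (MonoidHom.id G) hNN) := by
      apply comap_injective (QuotientGroup.mk'_surjective N)
      rw [hOcore N hN hNK, ← hOcore N₁ hN₁o inf_le_right]
      rfl
    have := frattiniPCore_eq_comap (p := p) (quotientGroup_map_id_surjective hNN) hc ?_
    · rw [this]
      rfl
    · rw [ker_quotientGroup_map_id]
      refine le_frattiniPCore_of_nongenerating ?_ fun M hM hle => ?_
      · rw [map_le_iff_le_comap, hOcore N hN hNK]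
        exact inf_le_right.trans hKO
      · have hNM : N ≤ M.comap (QuotientGroup.mk' N) := by
          intro g hg
          rw [mem_comap, (QuotientGroup.eq_one_iff (N := N) g).2 hg |> (id : _ → QuotientGroup.mk' N g = 1)]
          exact one_mem _
        have h1 : O ≤ M.comap (QuotientGroup.mk' N) := by
          refine hgen _ (isOpen_mono hNM hN) ?_ fun g hg => ?_
          · rw [← hOcore N hN hNK]
            exact comap_mono hM
          · rw [← hOcore N hN hNK] at hg
            obtain ⟨m, hm, _, ⟨n, hn, rfl⟩, e⟩ := mem_sup_of_normal_right.1 (hle hg)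
            have e2 : g = g * n⁻¹ * n := by group
            rw [e2]
            refine mul_mem (mem_sup_left ?_) (mem_sup_right hn.1)
            rw [mem_comap, map_mul, map_inv, ← e, mul_inv_cancel_right]
            exact hm
        intro x hx
        obtain ⟨g, rfl⟩ := QuotientGroup.mk'_surjective N x
        refine h1 ?_
        rw [← hOcore N hN hNK]
        exact hx

end Converse

/-! ### The chain of open normal subgroups and its inverse system. -/

section Converse

variable {G : Type u} [Group G] [TopologicalSpace G]

/-- Descending open normal subgroups `U n` and `N n` of `G` such that the quotients `G ⧸ N n` with the
images of the subgroups `U n` form an admissible inverse system. -/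
structure IsObliqueChain (p : ℕ) (F : Subgroup G) (U N : ℕ → Subgroup G) : Prop where
  isOpen_U : ∀ n, IsOpen (U n : Set G)
  normal_U : ∀ n, (U n).Normal
  isOpen_N : ∀ n, IsOpen (N n : Set G)
  normal_N : ∀ n, (N n).Normal
  U_zero_le : U 0 ≤ F
  U_lt : ∀ n, U (n + 1) < U n
  -- With A_n = U n / N n, the two halves of (i) come from `nongenerating` and `U_le_N`; `le_or_le`,
  -- `comap_frattini` and `zero_le` give (ii), (iii) and (iv).
  N_le_U : ∀ n, N n ≤ U (n + 1)
  U_le_N : ∀ n, U (n + 2) ≤ N n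
  nongenerating : ∀ n, ∀ L : Subgroup G, IsOpen (L : Set G) → L ≤ U (n + 1) →
    U (n + 1) ≤ L ⊔ N n → U (n + 1) ≤ L
  le_or_le : ∀ n, ∀ K : Subgroup G, IsOpen (K : Set G) → K ≤ F → F ≤ normalizer (K : Set G) →
    U (n + 1) ≤ K ∨ K ≤ U n
  zero_le : ∀ K : Subgroup G, IsOpen (K : Set G) → K.Normal → ¬ K ≤ F → U 0 ≤ K
  comap_frattini : ∀ n, haveI := normal_N n
    (frattiniPCore p (G ⧸ N n)).comap (QuotientGroup.mk' (N n)) = F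

theorem IsHereditarilyJustInfinite.exists_isObliqueChain {p : ℕ} [Fact p.Prime]
    (hG : IsHereditarilyJustInfinite G) (hV : IsVirtuallyProPGroup p G) :
    ∃ (F : Subgroup G) (U N : ℕ → Subgroup G), IsObliqueChain p F U N := by
  obtain ⟨h1, h2, h3, h4⟩ := hV.profinite
  have hinf := hG.justInfinite.infinite
  obtain ⟨O, F, N₁, hO, hOp, hF, hFn, hFO, hN₁, hN₁n, hN₁F, hfr⟩ := hG.exists_frattini hV
  obtain ⟨Q₁, hQ₁, hQ₁n, hQ₁K⟩ := hG.exists_le_of_not_le hO hOp (H := ⊤) isOpen_univ hF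
  set T := {U : Subgroup G // IsOpen (U : Set G) ∧ U.Normal ∧ U ≤ N₁ ⊓ Q₁} with hT
  have step : ∀ U : T, ∃ (N : Subgroup G) (U' : T), IsOpen (N : Set G) ∧ N.Normal ∧ N ≤ U.1 ∧
      U'.1 ≤ N ∧ U'.1 < U.1 ∧
      (∀ L : Subgroup G, IsOpen (L : Set G) → L ≤ U.1 → U.1 ≤ L ⊔ N → U.1 ≤ L) ∧
      (∀ K : Subgroup G, IsOpen (K : Set G) → K ≤ F → F ≤ normalizer (K : Set G) →
        U'.1 ≤ K ∨ K ≤ U.1) := by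
    rintro ⟨U, hU, hUn, hUle⟩
    obtain ⟨N, hN, hNn, hNU, hgen⟩ := hG.exists_nongenerating hU
      (hOp.mono (hUle.trans (inf_le_left.trans (hN₁F.trans hFO))))
    obtain ⟨Q, hQ, hQn, hQK⟩ := hG.exists_le_of_not_le hO hOp hF hU
    have hU1 : U ≠ ⊥ := by
      rintro rfl
      have := finite_of_isOpen_of_finite hU inferInstance
      exact not_finite G
    obtain ⟨x, hxU, hx1⟩ := (U.bot_or_exists_ne_one).resolve_left hU1
    -- Avoiding x makes the next term strictly smaller than U.
    obtain ⟨V, hV, hVn, hxV⟩ := exists_isOpen_normal_notMem hx1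
    refine ⟨N, ⟨N ⊓ Q ⊓ V, (hN.inter hQ).inter hV, inferInstance,
      inf_le_left.trans (inf_le_left.trans (hNU.trans hUle))⟩, hN, hNn, hNU,
      inf_le_left.trans inf_le_left, ?_, hgen, fun K hK hKF hKn => ?_⟩
    · exact SetLike.lt_iff_le_and_exists.2
        ⟨inf_le_left.trans (inf_le_left.trans hNU), x, hxU, fun h => hxV h.2⟩
    · by_cases h : K ≤ U
      · exact Or.inr h
      · exact Or.inl (inf_le_left.trans (inf_le_right.trans (hQK K hK hKF hKn h)))
  choose N U' hN hNn hNU hUN hlt hgen hob using step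
  let V : ℕ → T := fun n => U'^[n] ⟨N₁ ⊓ Q₁, hN₁.inter hQ₁, inferInstance, le_rfl⟩
  have hVs : ∀ n, V (n + 1) = U' (V n) := fun n => Function.iterate_succ_apply' _ _ _
  have hNs : ∀ n, N (V n) ≤ N₁ := fun n => (hNU _).trans ((V n).2.2.2.trans inf_le_left)
  -- The n-th N is chosen for the (n + 1)-st U, so A_n keeps a nontrivial image modulo N n.
  refine ⟨F, fun n => (V n).1, fun n => N (V (n + 1)), fun n => (V n).2.1, fun n => (V n).2.2.1,
    fun n => hN _, fun n => hNn _, inf_le_left.trans hN₁F, fun n => ?_, fun n => hNU _, fun n => ?_,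
    fun n => hgen _, fun n => ?_, fun K hK hKn hKF => ?_, fun n => ?_⟩
  · simp only [hVs]
    exact hlt _
  · change (V (n + 1 + 1)).1 ≤ _
    rw [hVs (n + 1)]
    exact hUN _
  · simp only [hVs]
    exact hob _
  · exact inf_le_right.trans (hQ₁K K hK le_top (normalizer_eq_top_iff.2 hKn).ge hKF)
  · have := hNn (V (n + 1))
    exact hfr _ (hN _) (hNs _)

namespace IsObliqueChain

variable {p : ℕ} {F : Subgroup G} {U N : ℕ → Subgroup G} (h : IsObliqueChain p F U N)
include h

theorem N_le_N (n : ℕ) : N (n + 1) ≤ N n := (h.N_le_U (n + 1)).trans (h.U_le_N n)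

theorem U_le_frattini (n : ℕ) : U n ≤ F := by
  induction n with
  | zero => exact h.U_zero_le
  | succ n ih => exact (h.U_lt n).le.trans ih

variable [IsTopologicalGroup G] [CompactSpace G]

/-- The inverse system of the quotients `G ⧸ N n`. -/
def quotientSystem : FiniteInverseSystem.{u} :=
  haveI := h.normal_N
  haveI : ∀ n, Finite (G ⧸ N n) := fun n => (N n).quotient_finite_of_isOpen (h.isOpen_N n)
  { G := fun n => G ⧸ N n
    ρ := fun n => QuotientGroup.map (N (n + 1)) (N n) (MonoidHom.id G) (h.N_le_N n)
    surjective := fun n => quotientGroup_map_id_surjective (h.N_le_N n) }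

/-- The projection of `G` to a term of the quotient system. -/
def toQuotient (n : ℕ) : G →* h.quotientSystem.G n :=
  haveI := h.normal_N
  QuotientGroup.mk' (N n)

theorem toQuotient_surjective (n : ℕ) : Function.Surjective (h.toQuotient n) :=
  haveI := h.normal_N n
  QuotientGroup.mk'_surjective (N n)

theorem ker_toQuotient (n : ℕ) : (h.toQuotient n).ker = N n :=
  haveI := h.normal_N n
  QuotientGroup.ker_mk' (N n)

theorem rho_comp_toQuotient (n : ℕ) : (h.quotientSystem.ρ n).comp (h.toQuotient (n + 1)) = h.toQuotient n := rfl

theorem rho_toQuotient (n : ℕ) (g : G) : h.quotientSystem.ρ n (h.toQuotient (n + 1) g) = h.toQuotient n g := rfl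

theorem comap_F (n : ℕ) : (h.quotientSystem.F p n).comap (h.toQuotient n) = F := h.comap_frattini n

theorem isOpen_comap (n : ℕ) (K : Subgroup (h.quotientSystem.G n)) :
    IsOpen ((K.comap (h.toQuotient n) : Subgroup G) : Set G) := by
  refine isOpen_mono ?_ (h.isOpen_N n)
  rw [← h.ker_toQuotient n, MonoidHom.ker]
  exact comap_mono bot_le

theorem comap_map_U (n : ℕ) : ((U n).map (h.toQuotient n)).comap (h.toQuotient n) = U n := by
  rw [comap_map_eq, h.ker_toQuotient, sup_eq_left]
  exact (h.N_le_U n).trans (h.U_lt n).le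

theorem ker_rho (n : ℕ) : (h.quotientSystem.ρ n).ker = (N n).map (h.toQuotient (n + 1)) := by
  apply comap_injective (h.toQuotient_surjective (n + 1))
  rw [MonoidHom.comap_ker, rho_comp_toQuotient, ker_toQuotient, comap_map_eq, h.ker_toQuotient, sup_eq_left.2 (h.N_le_N n)]

theorem le_normalizer_comap {n : ℕ} {K : Subgroup (h.quotientSystem.G n)}
    (hK : h.quotientSystem.F p n ≤ normalizer (K : Set (h.quotientSystem.G n))) :
    F ≤ normalizer (K.comap (h.toQuotient n) : Set G) := by
  refine mem_normalizer_of_conj_mem fun g hg l hl => ?_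
  rw [← h.comap_F n] at hg
  rw [mem_comap, map_mul, map_mul, map_inv]
  exact conj_mem_of_le_normalizer hK hg hl

theorem isAdmissible : h.quotientSystem.IsAdmissible p fun n => (U n).map (h.toQuotient n) := by
  refine ⟨fun n e => ?_, fun n => ?_, fun n => ?_, fun n => ?_, fun n K hK => ?_, fun n => ?_,
    fun K hK => ?_⟩
  · refine (h.U_lt n).not_ge (le_trans ?_ (h.N_le_U n))
    rwa [Subgroup.map_eq_bot_iff, h.ker_toQuotient] at e
  · rw [isNormalIn_iff, map_le_iff_le_comap, h.comap_F]
    have := h.normal_U n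
    have := Normal.map this (h.toQuotient n) (h.toQuotient_surjective n)
    exact ⟨h.U_le_frattini n, le_top.trans (normalizer_eq_top_iff.2 this).ge⟩
  · refine le_sInf fun B hB => ?_
    simp only [Set.mem_ofPred_eq] at hB
    by_contra hle
    set A := (U (n + 1)).map (h.toQuotient (n + 1)) with hA
    have hBA := hB.prop.1
    have hker : (h.quotientSystem.ρ n).ker ≤ A := by
      rw [ker_rho]
      exact Subgroup.map_mono (h.N_le_U n)
    -- The product of B with the kernel is again invariant, so by maximality it is all of A unless B
    -- contains the kernel.
    have hsup : B ⊔ (h.quotientSystem.ρ n).ker = A := by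
      refine (sup_le hBA.le hker).antisymm (not_lt_iff_le_imp_ge.1 ?_ (sup_le hBA.le hker))
      intro hlt
      refine hle (le_sup_right.trans (hB.le_of_ge ⟨hlt, ?_⟩ le_sup_left))
      refine mem_normalizer_of_conj_mem fun g hg l hl => ?_
      obtain ⟨b, hb, k, hk, rfl⟩ := mem_sup_of_normal_right.1 hl
      have e : g * (b * k) * g⁻¹ = (g * b * g⁻¹) * (g * k * g⁻¹) := by group
      rw [e]
      exact mul_mem (mem_sup_left (conj_mem_of_le_normalizer hB.prop.2 hg hb))
        (mem_sup_right ((MonoidHom.normal_ker _).conj_mem k hk g))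
    have hUB := h.nongenerating n (B.comap (h.toQuotient (n + 1))) (h.isOpen_comap _ _) ?_ ?_
    · exact hBA.not_ge (map_le_iff_le_comap.2 hUB)
    · rw [← h.comap_map_U (n + 1)]
      exact comap_mono hBA.le
    · intro u hu
      have hu' : h.toQuotient (n + 1) u ∈ B ⊔ (h.quotientSystem.ρ n).ker := by
        rw [hsup]
        exact mem_map_of_mem _ hu
      obtain ⟨b, hb, k, hk, e⟩ := mem_sup_of_normal_right.1 hu'
      rw [ker_rho] at hk
      obtain ⟨m, hm, rfl⟩ := hk
      have e2 : u = u * m⁻¹ * m := by group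
      rw [e2]
      refine mul_mem (mem_sup_left ?_) (mem_sup_right hm)
      rw [mem_comap, map_mul, map_inv, ← e, mul_inv_cancel_right]
      exact hb
  · rw [FiniteInverseSystem.P, Subgroup.map_map, rho_comp_toQuotient, ker_rho]
    exact Subgroup.map_mono (h.U_le_N n)
  · rw [FiniteInverseSystem.P, Subgroup.map_map, rho_comp_toQuotient]
    obtain ⟨hKF, hKn⟩ := isNormalIn_iff.1 hK
    refine (h.le_or_le n (K.comap (h.toQuotient n)) (h.isOpen_comap _ _) ?_ (h.le_normalizer_comap hKn)).imp
      (fun h1 => map_le_iff_le_comap.2 h1) fun h1 => ?_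
    · exact (comap_mono hKF).trans (h.comap_F n).le
    · rwa [← h.comap_map_U n, comap_le_comap_of_surjective (h.toQuotient_surjective n)] at h1
  · apply comap_injective (h.toQuotient_surjective (n + 1))
    rw [comap_F, comap_comap, rho_comp_toQuotient, comap_F]
  · by_contra hKF
    obtain ⟨hKn, hK1⟩ := hK.prop
    have h1 : U 0 ≤ K.comap (h.toQuotient 0) := by
      refine h.zero_le _ (h.isOpen_comap _ _) inferInstance fun hle => hKF ?_
      exact (comap_le_comap_of_surjective (h.toQuotient_surjective 0)).1 (hle.trans (h.comap_F 0).ge)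
    -- A minimal normal K outside F contains the nontrivial normal image of U 0, hence equals it,
    -- although U 0 ≤ F.
    have h2 : K ≤ (U 0).map (h.toQuotient 0) := by
      refine hK.le_of_le ⟨Normal.map (h.normal_U 0) _ (h.toQuotient_surjective 0), fun e => ?_⟩
        (map_le_iff_le_comap.2 h1)
      refine (h.U_lt 0).not_ge (le_trans ?_ (h.N_le_U 0))
      rwa [Subgroup.map_eq_bot_iff, h.ker_toQuotient] at e
    refine hKF (h2.trans (map_le_iff_le_comap.2 ?_))
    rw [h.comap_F]
    exact h.U_zero_le

/-- A nontrivial intersection would have finite index, bounding the strictly increasing indices of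
the U n. -/
theorem iInf_N (hG : IsJustInfinite G) : ⨅ n, N n = ⊥ := by
  by_contra hne
  have hn := h.normal_N
  have hU : ∀ n, (U n).FiniteIndex := fun n => finiteIndex_of_isOpen (h.isOpen_U n)
  have hfin : (⨅ n, N n).FiniteIndex := by
    refine hG.finiteIndex _ ?_ (normal_iInf_normal hn) hne
    rw [coe_iInf]
    exact isClosed_iInter fun n => (N n).isClosed_of_isOpen (h.isOpen_N n)
  have hlt : ∀ n, n ≤ (U n).index := by
    intro n
    induction n with
    | zero => exact Nat.zero_le _
    | succ n ih => exact ih.trans_lt (index_strictAnti (h.U_lt n))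
  have hle : ∀ n, (U n).index ≤ (⨅ n, N n).index := fun n =>
    index_antitone ((iInf_le N n).trans ((h.N_le_U n).trans (h.U_lt n).le))
  exact absurd ((hlt _).trans (hle ((⨅ n, N n).index + 1))) (by simp)

/-- The map to the limit of the quotient system. -/
def toLimit : G →* h.quotientSystem.limit :=
  (MonoidHom.pi h.toQuotient).codRestrict _ fun _ _ => rfl

theorem proj_toLimit (n : ℕ) (g : G) : h.quotientSystem.proj n (h.toLimit g) = h.toQuotient n g := rfl

theorem continuous_toQuotient (n : ℕ) : Continuous (h.toQuotient n) := by
  refine continuous_discrete_rng.2 fun b => ?_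
  obtain ⟨g, rfl⟩ := h.toQuotient_surjective n b
  have hc : Continuous fun x : G => g⁻¹ * x := by fun_prop
  convert (h.isOpen_N n).preimage hc using 1
  ext x
  rw [Set.mem_preimage, Set.mem_preimage, Set.mem_singleton_iff, SetLike.mem_coe, ← h.ker_toQuotient n,
    MonoidHom.mem_ker, map_mul, map_inv, inv_mul_eq_one, eq_comm]

theorem continuous_toLimit : Continuous h.toLimit :=
  (continuous_pi h.continuous_toQuotient).subtype_mk _

theorem toLimit_injective (hG : IsJustInfinite G) : Function.Injective h.toLimit := by
  rw [← MonoidHom.ker_eq_bot_iff, eq_bot_iff, ← h.iInf_N hG]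
  refine le_iInf fun n g hg => ?_
  rw [← h.ker_toQuotient n, MonoidHom.mem_ker, ← h.proj_toLimit, MonoidHom.mem_ker.1 hg, map_one]

/-- The preimages in G of the coordinates of x are nested nonempty compact sets; a common point maps
to x. -/
theorem toLimit_surjective : Function.Surjective h.toLimit := by
  intro x
  have hcl : ∀ n, IsClosed (h.toQuotient n ⁻¹' {h.quotientSystem.proj n x}) := fun n =>
    (isClosed_discrete _).preimage (h.continuous_toQuotient n)
  have hmono : ∀ n, h.toQuotient (n + 1) ⁻¹' {h.quotientSystem.proj (n + 1) x} ⊆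
      h.toQuotient n ⁻¹' {h.quotientSystem.proj n x} := by
    intro n g hg
    rw [Set.mem_preimage, Set.mem_singleton_iff] at hg ⊢
    rw [← rho_toQuotient, hg, FiniteInverseSystem.rho_proj]
  obtain ⟨g, hg⟩ := IsCompact.nonempty_iInter_of_sequence_nonempty_isCompact_isClosed _ hmono
    (fun n => (h.toQuotient_surjective n _).imp fun _ => id) (hcl 0).isCompact hcl
  exact ⟨g, FiniteInverseSystem.ext_proj _ fun n => Set.mem_iInter.1 hg n⟩

theorem nonempty_continuousMulEquiv (hG : IsJustInfinite G) :
    Nonempty (G ≃ₜ* h.quotientSystem.limit) := by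
  have hb : Function.Bijective h.toLimit := ⟨h.toLimit_injective hG, h.toLimit_surjective⟩
  have hc : Continuous (Equiv.ofBijective _ hb) := h.continuous_toLimit
  exact ⟨{ MulEquiv.ofBijective h.toLimit hb with
    continuous_toFun := h.continuous_toLimit
    continuous_invFun := (Continuous.homeoOfEquivCompactToT2 hc).symm.continuous }⟩

end IsObliqueChain

end Converse

theorem theorem5p5 (p : ℕ) [Fact p.Prime] :
    (∀ (Λ : FiniteInverseSystem.{u}) (A : ∀ n, Subgroup (Λ.G n)), Λ.IsAdmissible p A →
      IsHereditarilyJustInfinite Λ.limit ∧ IsVirtuallyProPGroup p Λ.limit) ∧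
    (∀ (G : Type u) [Group G] [TopologicalSpace G],
      IsHereditarilyJustInfinite G → IsVirtuallyProPGroup p G →
      ∃ (Λ : FiniteInverseSystem.{u}) (A : ∀ n, Subgroup (Λ.G n)), Λ.IsAdmissible p A ∧
        Nonempty (G ≃ₜ* Λ.limit)) := by
  refine ⟨fun Λ A h => ⟨h.isHereditarilyJustInfinite, h.isVirtuallyProPGroup⟩, ?_⟩
  intro G _ _ hG hV
  obtain ⟨_, _, _, h⟩ := hG.exists_isObliqueChain hV
  have := hV.profinite.isTopologicalGroup
  have := hV.profinite.compactSpace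
  exact ⟨h.quotientSystem, _, h.isAdmissible, h.nonempty_continuousMulEquiv hG.justInfinite⟩
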